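/- Let $N\ge 1$ be an integer. Let $P_N(y)=\sum_{k=0}^{N-1}\binom{N-1+k}{k}y^k$ and $Q_N(z)=z^{N-1}P_N\!\left(\frac{2-z-z^{-1}}{4}\right)$, a polynomial in $z$. Let $L_N(z)=\prod_{r}(z-r)$, the product being over the complex roots $r$ of $Q_N$ with $|r|>1$, counted with multiplicity. Define the (minimum-phase) Daubechies filter $h_0,\dots,h_{2N-1}\in\mathbb R$ by $$\frac{1}{\sqrt2}\sum_{l=0}^{2N-1}h_l z^l=\left(\frac{1+z}{2}\right)^{N}\frac{L_N(z)}{L_N(1)},$$ and put $g_l=(-1)^l h_{2N-1-l}$ for $0\le l\le 2N-1$. A Daubechies wavelet dBN is a function $\psi:\mathbb R\to\mathbb R$ with $$\psi(t)=\sqrt2\sum_{l=0}^{2N-1}g_l\,\varphi(2t-l)\quad\text{for almost every } t,$$ where $\varphi:\mathbb R\to\mathbb R$, $\varphi\in L^1(\mathbb R)\cap L^2(\mathbb R)$, satisfies $\int_{\mathbb R}\varphi(t)\,dt=1$ and the two-scale relation $\varphi(t)=\sqrt2\sum_{l=0}^{2N-1}h_l\,\varphi(2t-l)$ for almost every $t$.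 Then such a $\psi$ exists, and for every such $\psi$ the function $\psi^2\log_2\psi^2$ (with $0\log_2 0=0$) is integrable on $\mathbb R$, and the time Shannon entropy satisfies $$H_t(\psi):=-\int_{-\infty}^{+\infty}\psi^2(t)\log_2\psi^2(t)\,dt\;\le\;\log_2(2N-1).$$ -/

import Mathlib

open MeasureTheory

noncomputable section

/-- The time Shannon entropy (in bits) of a real wavelet `ψ`:
`H_t(ψ) = -∫ ψ(t)² log₂ ψ(t)² dt`, with the convention `0 * log 0 = 0`. -/
def timeEntropy (ψ : ℝ → ℝ) : ℝ :=
  -∫ t : ℝ, ψ t ^ 2 * Real.logb 2 (ψ t ^ 2)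

/-- The polynomial `Q_N(z) = z^(N-1) P_N(y)`, where `y = (2 - z - z⁻¹) / 4 = -(1 - z)² / (4 z)` and
`P_N(y) = ∑_{k < N} (N - 1 + k choose k) y^k`. For `z = e^{-iω}` one has `y = sin²(ω/2)`. -/
def daubechiesProductPoly (N : ℕ) : Polynomial ℂ :=
  ∑ k ∈ Finset.range N,
    Polynomial.C (((N - 1 + k).choose k : ℂ) * (-1 / 4) ^ k) *
      (1 - Polynomial.X) ^ (2 * k) * Polynomial.X ^ (N - 1 - k)

/-- The monic polynomial whose roots are the roots of `Q_N` outside the unit circle, with their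
multiplicities (the minimum-phase spectral factor of `Q_N`, up to normalisation). -/
def daubechiesSpectralFactor (N : ℕ) : Polynomial ℂ :=
  open Classical in
  (((daubechiesProductPoly N).roots.filter (fun r => 1 < ‖r‖)).map
    (fun r => Polynomial.X - Polynomial.C r)).prod

/-- The symbol `m₀(z) = ((1 + z) / 2)^N L_N(z) / L_N(1)` of the low-pass filter of dBN, where
`z = e^{-iω}` and `L_N` is the minimum-phase spectral factor. -/
def daubechiesSymbol (N : ℕ) : Polynomial ℂ :=
  (Polynomial.C (1 / 2) * (1 + Polynomial.X)) ^ N *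
    (Polynomial.C ((daubechiesSpectralFactor N).eval 1)⁻¹ * daubechiesSpectralFactor N)

/-- The low-pass filter coefficients `h_0, …, h_{2N-1}` of dBN, normalised by `∑ h_l = √2`.
The coefficients of the symbol are real, because the roots of `Q_N` come in conjugate pairs. -/
def daubechiesLowPass (N l : ℕ) : ℝ :=
  √2 * ((daubechiesSymbol N).coeff l).re

/-- The high-pass filter coefficients `g_l = (-1)^l h_{2N-1-l}`, `0 ≤ l ≤ 2N-1`. -/
def daubechiesHighPass (N l : ℕ) : ℝ :=
  (-1) ^ l * daubechiesLowPass N (2 * N - 1 - l)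

/-- `φ` is (a representative of) the scaling function of dBN: the function in `L¹ ∩ L²` with
integral one that satisfies the two-scale relation `φ(t) = √2 ∑ h_l φ(2t - l)`. -/
structure IsDaubechiesScalingFunction (N : ℕ) (φ : ℝ → ℝ) : Prop where
  integrable : Integrable φ volume
  memLp_two : MemLp φ 2 volume
  integral_eq_one : ∫ t : ℝ, φ t = 1
  two_scale : ∀ᵐ t : ℝ, φ t =
    √2 * ∑ l ∈ Finset.range (2 * N), daubechiesLowPass N l * φ (2 * t - (l : ℝ))

/-- `ψ` is (a representative of) the Daubechies wavelet dBN: `ψ(t) = √2 ∑ g_l φ(2t - l)`, where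
`φ` is the scaling function. -/
def IsDaubechiesWavelet (N : ℕ) (ψ : ℝ → ℝ) : Prop :=
  ∃ φ : ℝ → ℝ, IsDaubechiesScalingFunction N φ ∧
    ∀ᵐ t : ℝ, ψ t =
      √2 * ∑ l ∈ Finset.range (2 * N), daubechiesHighPass N l * φ (2 * t - (l : ℝ))

end

/-! For `N ≥ 2` three facts suffice: `ψ` is bounded, vanishes a.e. outside an interval of length `L
= 2N - 1`, and has `∫ ψ² ≤ 1`. Integrating `log u ≤ u - 1` at `u = 1 / (ψ² L)` against `ψ²` gives
`-∫ ψ² log ψ² ≤ 1 + (∫ ψ²)(log L - 1)`, which is at most `log L` because `L ≥ 3 > e`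
(`integrable_and_timeEntropy_le`). Orthonormality of the translates of `φ` is never needed, only the
inequality `∫ ψ² ≤ 1`.

The three facts come from the Fourier side. The Bézout identity for `P_N` and the pairing `r ↔ r⁻¹`
of the roots of `Q_N` give the mirror condition `|m(x)|² + |m(x + 1/2)|² = 1` for the low-pass mask
`m`. The two-scale relation and `∫ φ = 1` force the transform of `φ` to be `Φ(w) = ∏ m(w / 2^j)`.
The zero of `m` of order `N` and `P_N(1) < 4^(N-1)` make `Φ` decay faster than `1 / |w|`, so `φ` is
a.e. a bounded inverse transform (`exists_norm_maskProd_le`). It is a weak limit of cascade iterates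
supported in `[0, 2N - 1]` (`fourierInv_maskProd_eq_zero`). Finally `‖ψ‖ = ‖φ‖` by Plancherel and
the mirror condition, and `‖Φ‖ ≤ 1` because the partial products have norm one over a period
(`integral_sq_wavelet_le_one`).

For `N = 1` the decay estimate fails, but `ψ` is the Haar wavelet: `ψ²` is a.e. `0` or `1`, and both
sides are `0`. -/

open scoped FourierTransform ContDiff
open Filter Topology

/-! ### The polynomial `P_N` and its Bézout identity -/

/-- The truncated binomial series `P_N(y) = ∑_{k < N} (N - 1 + k choose k) y^k`. -/
def daubechiesBezoutSum {R : Type*} [Semiring R] (N : ℕ) (y : R) : R :=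
  ∑ k ∈ Finset.range N, ((N - 1 + k).choose k : R) * y ^ k

/-- The sums truncate the series of `(1 - y)^(-(n+2))` and `(1 - y)^(-(n+1))`; Pascal's rule leaves
a single boundary term. -/
theorem one_sub_mul_sum_choose {R : Type*} [CommRing R] (n M : ℕ) (y : R) :
    (1 - y) * ∑ k ∈ Finset.range (M + 1), ((n + 1 + k).choose k : R) * y ^ k =
      ∑ k ∈ Finset.range (M + 1), ((n + k).choose k : R) * y ^ k -
        ((n + 1 + M).choose M : R) * y ^ (M + 1) := by
  induction M with
  | zero => simp
  | succ M ih =>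
    rw [Finset.sum_range_succ, mul_add, ih, Finset.sum_range_succ _ (M + 1)]
    have h : ((n + 1 + (M + 1)).choose (M + 1) : R) =
        ((n + 1 + M).choose M : R) + ((n + (M + 1)).choose (M + 1) : R) := by
      rw [show n + 1 + (M + 1) = (n + 1 + M) + 1 by ring, Nat.choose_succ_succ]
      push_cast
      rw [show n + 1 + M = n + (M + 1) by ring]
    rw [h]
    ring

theorem two_mul_choose_eq_centralBinom (n : ℕ) :
    2 * (2 * n + 1).choose (n + 1) = (n + 1).centralBinom := by
  rw [Nat.centralBinom_eq_two_mul_choose, show 2 * (n + 1) = (2 * n + 1) + 1 by ring,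
    Nat.choose_succ_succ (2 * n + 1) n, ← Nat.choose_symm_half]
  ring

/-- The Bézout identity behind the Daubechies filters. -/
theorem daubechiesBezoutSum_identity {R : Type*} [CommRing R] {N : ℕ} (hN : 1 ≤ N) {x y : R}
    (h : x + y = 1) :
    x ^ N * daubechiesBezoutSum N y + y ^ N * daubechiesBezoutSum N x = 1 := by
  obtain ⟨n, rfl⟩ : ∃ n, N = n + 1 := ⟨N - 1, by omega⟩
  have step : ∀ (n : ℕ) (y : R), (1 - y) * daubechiesBezoutSum (n + 2) y =
      daubechiesBezoutSum (n + 1) y + ((2 * n + 1).choose (n + 1) : R) * y ^ (n + 1) -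
        2 * ((2 * n + 1).choose (n + 1) : R) * y ^ (n + 2) := by
    intro n y
    have h1 := one_sub_mul_sum_choose n (n + 1) y
    have h2 : ((n + 1 + (n + 1)).choose (n + 1) : R) =
        2 * ((2 * n + 1).choose (n + 1) : R) := by
      have := two_mul_choose_eq_centralBinom n
      rw [Nat.centralBinom_eq_two_mul_choose] at this
      rw [show n + 1 + (n + 1) = 2 * (n + 1) by ring, ← this]
      push_cast
      ring
    simp only [daubechiesBezoutSum, Nat.add_sub_cancel, show n + 2 - 1 = n + 1 by omega]
    rw [h2, Finset.sum_range_succ (fun k => ((n + k).choose k : R) * y ^ k) (n + 1),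
      show n + (n + 1) = 2 * n + 1 by ring] at h1
    exact h1
  induction n with
  | zero => simpa [daubechiesBezoutSum] using h
  | succ n ih =>
    have hx := step n y
    have hy := step n x
    rw [show 1 - y = x by rw [← h]; ring] at hx
    rw [show 1 - x = y by rw [← h]; ring] at hy
    have ih := ih (by omega)
    set a : R := ((2 * n + 1).choose (n + 1) : R)
    calc x ^ (n + 1 + 1) * daubechiesBezoutSum (n + 1 + 1) y +
          y ^ (n + 1 + 1) * daubechiesBezoutSum (n + 1 + 1) x
        = x ^ (n + 1) * (x * daubechiesBezoutSum (n + 2) y) +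
          y ^ (n + 1) * (y * daubechiesBezoutSum (n + 2) x) := by ring
      -- The boundary terms of the two recursions carry the same coefficient `a`, and together
      -- contain the factor `1 - (x + y) = 0`.
      _ = (x ^ (n + 1) * daubechiesBezoutSum (n + 1) y +
          y ^ (n + 1) * daubechiesBezoutSum (n + 1) x) +
          2 * a * (x * y) ^ (n + 1) * (1 - (x + y)) := by rw [hx, hy]; ring
      _ = 1 := by rw [ih, h]; ring

theorem daubechiesBezoutSum_zero {R : Type*} [CommRing R] {N : ℕ} (hN : 1 ≤ N) :
    daubechiesBezoutSum N (0 : R) = 1 := by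
  have := daubechiesBezoutSum_identity hN (add_zero (1 : R))
  simpa [show N ≠ 0 by omega] using this

theorem one_le_daubechiesBezoutSum {N : ℕ} (hN : 1 ≤ N) {y : ℝ} (hy : 0 ≤ y) :
    1 ≤ daubechiesBezoutSum N y := by
  rw [← daubechiesBezoutSum_zero (R := ℝ) hN]
  exact Finset.sum_le_sum fun k _ => by gcongr

theorem daubechiesBezoutSum_le_at_one {N : ℕ} {y : ℝ} (hy : 0 ≤ y) (hy1 : y ≤ 1) :
    daubechiesBezoutSum N y ≤ daubechiesBezoutSum N 1 :=
  Finset.sum_le_sum fun k _ => by gcongr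

/-- At `y = 1` the truncated series sums (hockey stick) to half a central binomial coefficient. The
strict inequality, an equality at `N = 1`, is what later makes the infinite product integrable. -/
theorem daubechiesBezoutSum_one_lt {N : ℕ} (hN : 2 ≤ N) :
    daubechiesBezoutSum N (1 : ℝ) < 4 ^ (N - 1) := by
  obtain ⟨n, rfl⟩ : ∃ n, N = n + 2 := ⟨N - 2, by omega⟩
  have h1 := one_sub_mul_sum_choose (n + 1) (n + 1) (1 : ℝ)
  have hb : ∀ n : ℕ, (n + 2).centralBinom < 2 * 4 ^ (n + 1) := by
    intro n
    induction n with
    | zero => decide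
    | succ n ih =>
      have := Nat.succ_mul_centralBinom_succ (n + 2)
      have hpos := Nat.centralBinom_pos (n + 2)
      have h4 : (n + 1 + 2).centralBinom < 4 * (n + 2).centralBinom := by
        have h : (n + 3) * (n + 3).centralBinom < (n + 3) * (4 * (n + 2).centralBinom) := by
          rw [this]; nlinarith
        exact lt_of_mul_lt_mul_left h (by omega)
      rw [pow_succ]
      omega
  have h2 := two_mul_choose_eq_centralBinom (n + 1)
  rw [Nat.choose_symm_half] at h2
  have h3 : daubechiesBezoutSum (n + 2) (1 : ℝ) = ((2 * (n + 1) + 1).choose (n + 1) : ℝ) := by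
    simp only [daubechiesBezoutSum, show n + 2 - 1 = n + 1 by omega]
    rw [show n + 1 + 1 + (n + 1) = 2 * (n + 1) + 1 by ring] at h1
    simp only [one_pow, mul_one] at h1 ⊢
    linarith
  have h5 : (2 * (n + 1) + 1).choose (n + 1) < 4 ^ (n + 1) := by
    have := hb n
    rw [show n + 2 = n + 1 + 1 by ring] at this
    omega
  rw [h3, show n + 2 - 1 = n + 1 by omega]
  exact_mod_cast h5

/-! ### Spectral factorisation and the mirror condition -/

section SymbolAlgebra

open Polynomial

theorem eval_daubechiesProductPoly {N : ℕ} {z : ℂ} (hz : z ≠ 0) :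
    (daubechiesProductPoly N).eval z =
      z ^ (N - 1) * daubechiesBezoutSum N ((2 - z - z⁻¹) / 4) := by
  have hy : (2 - z - z⁻¹) / 4 = (-1 / 4) * (1 - z) ^ 2 * z⁻¹ := by field_simp; ring
  rw [daubechiesProductPoly, eval_finsetSum, daubechiesBezoutSum, Finset.mul_sum]
  refine Finset.sum_congr rfl fun k hk => ?_
  have hk' : k ≤ N - 1 := by have := Finset.mem_range.1 hk; omega
  obtain ⟨j, hj⟩ := Nat.exists_eq_add_of_le hk'
  rw [hy, show N - 1 - k = j by omega, hj]
  simp only [eval_mul, eval_pow, eval_C, eval_sub, eval_one, eval_X, mul_pow, ← pow_mul, inv_pow,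
    pow_add]
  field_simp

theorem eval_zero_daubechiesProductPoly_ne_zero {N : ℕ} (hN : 1 ≤ N) :
    (daubechiesProductPoly N).eval 0 ≠ 0 := by
  have h : (daubechiesProductPoly N).eval 0 =
      ((N - 1 + (N - 1)).choose (N - 1) : ℂ) * (-1 / 4) ^ (N - 1) := by
    rw [daubechiesProductPoly, eval_finsetSum, Finset.sum_eq_single (N - 1)]
    · simp
    · intro k hk hne
      have := Finset.mem_range.1 hk
      simp [show N - 1 - k ≠ 0 by omega]
    · intro h
      exact absurd (Finset.mem_range.2 (by omega)) h
  rw [h]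
  refine mul_ne_zero ?_ (pow_ne_zero _ (by norm_num))
  exact_mod_cast (Nat.choose_pos (by omega)).ne'

theorem daubechiesProductPoly_ne_zero {N : ℕ} (hN : 1 ≤ N) : daubechiesProductPoly N ≠ 0 := by
  intro h
  have := eval_zero_daubechiesProductPoly_ne_zero hN
  simp [h] at this

theorem natDegree_daubechiesProductPoly_le (N : ℕ) :
    (daubechiesProductPoly N).natDegree ≤ 2 * (N - 1) := by
  refine natDegree_sum_le_of_forall_le _ _ fun k hk => ?_
  have := Finset.mem_range.1 hk
  refine natDegree_mul_le.trans ?_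
  have h1 : (C (((N - 1 + k).choose k : ℂ) * (-1 / 4) ^ k) *
      (1 - X) ^ (2 * k)).natDegree ≤ 2 * k := by
    refine (natDegree_C_mul_le _ _).trans (natDegree_pow_le_of_le _ ?_ |>.trans (mul_one _).le)
    exact (natDegree_sub_le _ _).trans (by simp)
  rw [natDegree_X_pow]
  omega

theorem map_conj_daubechiesProductPoly (N : ℕ) :
    (daubechiesProductPoly N).map (starRingEnd ℂ) = daubechiesProductPoly N := by
  have h : ((starRingEnd ℂ) 4) = 4 := Complex.conj_ofNat 4
  simp [daubechiesProductPoly, Polynomial.map_sum, h]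

/-- The roots of `Q_N` are invariant under `r ↦ r⁻¹`, with multiplicities. -/
theorem roots_daubechiesProductPoly_inv {N : ℕ} (hN : 1 ≤ N) :
    (daubechiesProductPoly N).roots.map (·⁻¹) = (daubechiesProductPoly N).roots ∧
      Multiset.card (daubechiesProductPoly N).roots = 2 * (N - 1) := by
  set Q := daubechiesProductPoly N with hQ
  have hQ0 : Q ≠ 0 := daubechiesProductPoly_ne_zero hN
  have hs : Q = C Q.leadingCoeff * (Q.roots.map fun a => X - C a).prod :=
    (IsAlgClosed.splits Q).eq_prod_roots
  have hcard : Multiset.card Q.roots = Q.natDegree :=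
    (IsAlgClosed.splits Q).natDegree_eq_card_roots.symm
  obtain ⟨e, he⟩ := Nat.exists_eq_add_of_le
    (hcard.le.trans (natDegree_daubechiesProductPoly_le N))
  have hr0 : ∀ r ∈ Q.roots, r ≠ 0 := by
    rintro r hr rfl
    exact eval_zero_daubechiesProductPoly_ne_zero hN (mem_roots'.1 hr).2
  -- The variable `y = (2 - z - z⁻¹) / 4` is invariant under `z ↦ z⁻¹`, so `Q` is self-reciprocal.
  have hsym : ∀ z : ℂ, z ≠ 0 → Q.eval z = z ^ (2 * (N - 1)) * Q.eval z⁻¹ := by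
    intro z hz
    rw [hQ, eval_daubechiesProductPoly hz, eval_daubechiesProductPoly (inv_ne_zero hz), inv_inv,
      show 2 - z⁻¹ - z = 2 - z - z⁻¹ by ring, inv_pow, two_mul, pow_add]
    field_simp
  have hprod : ∀ (s : Multiset ℂ), (∀ r ∈ s, r ≠ 0) → ∀ z : ℂ, z ≠ 0 →
      z ^ (Multiset.card s) * (s.map fun a => X - C a).prod.eval z⁻¹ =
        (s.map fun a => -a).prod * ((s.map (·⁻¹)).map fun a => X - C a).prod.eval z := by
    intro s
    induction s using Multiset.induction with
    | empty => intro _ z _; simp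
    | cons a s ih =>
      intro hs z hz
      have ha := hs a (by simp)
      have := ih (fun r hr => hs r (by simp [hr])) z hz
      simp only [Multiset.map_cons, Multiset.prod_cons, Multiset.card_cons, eval_mul, eval_sub,
        eval_X, eval_C, pow_succ]
      calc _ = (z ^ (Multiset.card s) * (s.map fun a => X - C a).prod.eval z⁻¹) *
            (z * (z⁻¹ - a)) := by ring
        _ = (z * (z⁻¹ - a)) * ((s.map fun a => -a).prod *
            ((s.map (·⁻¹)).map fun a => X - C a).prod.eval z) := by rw [this]; ring
        _ = _ := by
          rw [show z * (z⁻¹ - a) = -a * (z - a⁻¹) by field_simp; ring]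
          ring
  have hc : Q.leadingCoeff * (Q.roots.map fun a => -a).prod ≠ 0 := by
    refine mul_ne_zero (leadingCoeff_ne_zero.2 hQ0) ?_
    refine Multiset.prod_ne_zero fun h => ?_
    obtain ⟨a, ha, h0⟩ := Multiset.mem_map.1 h
    exact hr0 a ha (neg_eq_zero.1 h0)
  -- Here `e` is the gap between `2(N - 1)` and the degree. A positive `e` would make `0` a root, so
  -- the degree is exactly `2(N - 1)` and comparing roots gives the symmetry.
  have hpoly : Q = C (Q.leadingCoeff * (Q.roots.map fun a => -a).prod) * X ^ e *
      ((Q.roots.map (·⁻¹)).map fun a => X - C a).prod := by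
    refine eq_of_infinite_eval_eq _ _ (Set.Infinite.mono (s := {z : ℂ | z ≠ 0}) ?_ ?_)
    · intro z (hz : z ≠ 0)
      change Q.eval z = _
      rw [hsym z hz, he, pow_add]
      have hs' := congrArg (eval z⁻¹) hs
      simp only [eval_mul, eval_C] at hs'
      rw [hs']
      simp only [eval_mul, eval_C, eval_pow, eval_X]
      linear_combination Q.leadingCoeff * z ^ e * hprod Q.roots hr0 z hz
    · exact (Set.finite_singleton (0 : ℂ)).infinite_compl
  have he0 : e = 0 := by
    by_contra hne
    apply eval_zero_daubechiesProductPoly_ne_zero hN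
    rw [← hQ, hpoly]
    simp [hne]
  subst he0
  refine ⟨?_, by simpa using he.symm⟩
  conv_rhs => rw [hpoly]
  rw [pow_zero, mul_one, roots_C_mul _ hc, roots_multiset_prod_X_sub_C]

theorem roots_daubechiesProductPoly_conj (N : ℕ) :
    (daubechiesProductPoly N).roots.map (starRingEnd ℂ) = (daubechiesProductPoly N).roots := by
  have := (IsAlgClosed.splits (daubechiesProductPoly N)).roots_map (starRingEnd ℂ)
  rw [map_conj_daubechiesProductPoly] at this
  exact this.symm

theorem two_sub_sub_inv_of_norm_eq_one {z : ℂ} (hz : ‖z‖ = 1) :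
    (2 - z - z⁻¹) / 4 = (((1 - z.re) / 2 : ℝ) : ℂ) := by
  have h : z⁻¹ = starRingEnd ℂ z := Complex.inv_eq_conj hz
  rw [h]
  have := Complex.add_conj z
  push_cast at this ⊢
  linear_combination (-1 / 4) * this

theorem norm_eval_daubechiesProductPoly {N : ℕ} (hN : 1 ≤ N) {z : ℂ} (hz : ‖z‖ = 1) :
    ‖(daubechiesProductPoly N).eval z‖ = daubechiesBezoutSum N ((1 - z.re) / 2) := by
  have hz0 : z ≠ 0 := by rintro rfl; simp at hz
  have hre : z.re ≤ 1 := hz ▸ Complex.re_le_norm z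
  rw [eval_daubechiesProductPoly hz0, two_sub_sub_inv_of_norm_eq_one hz, norm_mul, norm_pow, hz,
    one_pow, one_mul]
  have : daubechiesBezoutSum N ((((1 - z.re) / 2 : ℝ) : ℂ)) =
      ((daubechiesBezoutSum N ((1 - z.re) / 2) : ℝ) : ℂ) := by
    simp [daubechiesBezoutSum]
  rw [this, Complex.norm_real, Real.norm_of_nonneg]
  exact zero_le_one.trans (one_le_daubechiesBezoutSum hN (by linarith))

open Classical in
theorem daubechiesSpectralFactor_conj (N : ℕ) :
    (((daubechiesProductPoly N).roots.filter (fun r => 1 < ‖r‖)).map (starRingEnd ℂ)) =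
      (daubechiesProductPoly N).roots.filter (fun r => 1 < ‖r‖) := by
  conv_rhs => rw [← roots_daubechiesProductPoly_conj N]
  rw [Multiset.filter_map]
  simp

open Classical in
-- No root lies on the unit circle, since there `|Q_N| = P_N(y) ≥ 1` with `y ≥ 0`; inversion
-- therefore exchanges the roots outside with those inside.
theorem daubechiesProductPoly_roots_eq {N : ℕ} (hN : 1 ≤ N) :
    (daubechiesProductPoly N).roots =
      (daubechiesProductPoly N).roots.filter (fun r => 1 < ‖r‖) +
        ((daubechiesProductPoly N).roots.filter (fun r => 1 < ‖r‖)).map (·⁻¹) := by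
  have h1 : ((daubechiesProductPoly N).roots.filter (fun r => 1 < ‖r‖)).map (·⁻¹) =
      (daubechiesProductPoly N).roots.filter (fun r => ¬ 1 < ‖r‖) := by
    conv_rhs => rw [← (roots_daubechiesProductPoly_inv hN).1]
    rw [Multiset.filter_map]
    congr 1
    refine Multiset.filter_congr fun r hr => ?_
    obtain ⟨-, hr⟩ := mem_roots'.1 hr
    have hr0 : r ≠ 0 := by
      rintro rfl
      exact eval_zero_daubechiesProductPoly_ne_zero hN hr
    have hne : ‖r‖ ≠ 1 := by
      intro h
      have h1 := norm_eval_daubechiesProductPoly hN h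
      rw [hr, norm_zero] at h1
      have h2 : r.re ≤ 1 := h ▸ Complex.re_le_norm r
      have := one_le_daubechiesBezoutSum hN (y := (1 - r.re) / 2) (by linarith)
      linarith
    simp only [Function.comp_apply, norm_inv]
    rw [not_lt, inv_le_one_iff₀]
    constructor
    · exact fun h => Or.inr h.le
    · rintro (h | h)
      · exact absurd (norm_pos_iff.2 hr0) (not_lt.2 h)
      · exact lt_of_le_of_ne h hne.symm
  rw [h1, Multiset.filter_add_not]

/-- For `|z| = 1`, reflection in the circle gives `|a| |z - a⁻¹| = |z - conj a|`. With conjugation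
symmetry, the inner roots contribute the same modulus as the outer ones, up to a constant. -/
theorem norm_prod_X_sub_C_inv (s : Multiset ℂ) (hs : ∀ r ∈ s, r ≠ 0) {z : ℂ} (hz : ‖z‖ = 1) :
    (s.map fun r => ‖r‖).prod * ‖((s.map (·⁻¹)).map fun a => X - C a).prod.eval z‖ =
      ‖((s.map (starRingEnd ℂ)).map fun a => X - C a).prod.eval z‖ := by
  induction s using Multiset.induction with
  | empty => simp
  | cons a s ih =>
    have ha := hs a (by simp)
    have ih := ih (fun r hr => hs r (by simp [hr]))
    have hz0 : z ≠ 0 := by rintro rfl; simp at hz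
    have key : ‖a‖ * ‖z - a⁻¹‖ = ‖z - starRingEnd ℂ a‖ := by
      calc ‖a‖ * ‖z - a⁻¹‖ = ‖z‖ * ‖starRingEnd ℂ z - a‖ := by
            rw [← norm_mul, ← norm_mul, mul_sub, mul_sub, mul_inv_cancel₀ ha,
              Complex.mul_conj, Complex.normSq_eq_norm_sq, hz, ← norm_neg]
            congr 1
            push_cast
            ring
        _ = ‖starRingEnd ℂ (starRingEnd ℂ z - a)‖ := by rw [hz, one_mul, RCLike.norm_conj]
        _ = _ := by simp
    simp only [Multiset.map_cons, Multiset.prod_cons, eval_mul, eval_sub, eval_X, eval_C,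
      norm_mul]
    rw [← ih, ← key]
    ring

/-- The spectral factorisation `‖L_N(z)‖² = ‖L_N(1)‖² P_N((1 - Re z) / 2)` on the unit circle. -/
theorem norm_sq_eval_daubechiesSpectralFactor {N : ℕ} (hN : 1 ≤ N) {z : ℂ} (hz : ‖z‖ = 1) :
    (daubechiesSpectralFactor N).eval 1 ≠ 0 ∧
    ‖(daubechiesSpectralFactor N).eval z‖ ^ 2 = ‖(daubechiesSpectralFactor N).eval 1‖ ^ 2 *
      daubechiesBezoutSum N ((1 - z.re) / 2) := by
  classical
  set Q := daubechiesProductPoly N with hQ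
  set s := Q.roots.filter (fun r => 1 < ‖r‖) with hs
  have hL : daubechiesSpectralFactor N = (s.map fun r => X - C r).prod := by
    rw [daubechiesSpectralFactor]
  have hQs : Q = C Q.leadingCoeff * (Q.roots.map fun a => X - C a).prod :=
    (IsAlgClosed.splits Q).eq_prod_roots
  have hr0 : ∀ r ∈ s, r ≠ 0 := by
    rintro r hr rfl
    have := (Multiset.mem_filter.1 hr).2
    norm_num at this
  have key : ∀ w : ℂ, ‖w‖ = 1 → (s.map fun r => ‖r‖).prod * ‖Q.eval w‖ =
      ‖Q.leadingCoeff‖ * ‖(daubechiesSpectralFactor N).eval w‖ ^ 2 := by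
    intro w hw
    have h1 := norm_prod_X_sub_C_inv s hr0 hw
    rw [hs, hQ, daubechiesSpectralFactor_conj, ← hQ, ← hs] at h1
    have h2 : Q.eval w = Q.leadingCoeff * ((s.map fun a => X - C a).prod.eval w *
        ((s.map (·⁻¹)).map fun a => X - C a).prod.eval w) := by
      conv_lhs => rw [hQs, hQ, daubechiesProductPoly_roots_eq hN, ← hQ, ← hs]
      simp only [Multiset.map_add, Multiset.prod_add, eval_mul, eval_C]
    rw [h2, hL, norm_mul, norm_mul]
    linear_combination ‖Q.leadingCoeff‖ * ‖(s.map fun a => X - C a).prod.eval w‖ * h1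
  have hK : (s.map fun r => ‖r‖).prod ≠ 0 := by
    refine Multiset.prod_ne_zero fun h => ?_
    obtain ⟨a, ha, h0⟩ := Multiset.mem_map.1 h
    exact hr0 a ha (norm_eq_zero.1 h0)
  -- The unknown constants are eliminated by comparison with `z = 1`, where `P_N(0) = 1`.
  have h1 := key 1 (by simp)
  have hz' := key z hz
  rw [hQ, norm_eval_daubechiesProductPoly hN hz] at hz'
  rw [hQ, norm_eval_daubechiesProductPoly hN (by simp), ← hQ] at h1
  simp only [Complex.one_re, sub_self, zero_div] at h1
  rw [daubechiesBezoutSum_zero hN, mul_one] at h1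
  have hc : ‖Q.leadingCoeff‖ ≠ 0 := by
    rw [norm_ne_zero_iff, leadingCoeff_ne_zero]
    exact daubechiesProductPoly_ne_zero hN
  refine ⟨?_, ?_⟩
  · intro h
    rw [h] at h1
    rw [norm_zero, zero_pow two_ne_zero, mul_zero] at h1
    exact hK h1
  · rw [← hQ] at hz'
    apply mul_left_cancel₀ hc
    rw [← hz', h1]
    ring

theorem eval_one_daubechiesSymbol {N : ℕ} (hN : 1 ≤ N) : (daubechiesSymbol N).eval 1 = 1 := by
  have h := (norm_sq_eval_daubechiesSpectralFactor hN (z := 1) (by simp)).1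
  simp only [daubechiesSymbol, eval_mul, eval_pow, eval_C, eval_add, eval_one, eval_X]
  rw [inv_mul_cancel₀ h]
  norm_num

theorem norm_sq_eval_daubechiesSymbol {N : ℕ} (hN : 1 ≤ N) {z : ℂ} (hz : ‖z‖ = 1) :
    ‖(daubechiesSymbol N).eval z‖ ^ 2 =
      ((1 + z.re) / 2) ^ N * daubechiesBezoutSum N ((1 - z.re) / 2) := by
  obtain ⟨h1, h2⟩ := norm_sq_eval_daubechiesSpectralFactor hN hz
  have h3 : ‖(1 / 2 : ℂ) * (1 + z)‖ ^ 2 = (1 + z.re) / 2 := by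
    have hz' : Complex.normSq z = 1 := by rw [Complex.normSq_eq_norm_sq, hz, one_pow]
    rw [norm_mul, mul_pow, ← Complex.normSq_eq_norm_sq (1 + z), Complex.normSq_add, hz']
    simp
    ring
  simp only [daubechiesSymbol, eval_mul, eval_pow, eval_C, eval_add, eval_one, eval_X, norm_mul,
    norm_pow, norm_inv]
  rw [← norm_mul, mul_pow, mul_pow, h2, ← pow_mul, mul_comm N 2, pow_mul, h3]
  have : ‖(daubechiesSpectralFactor N).eval 1‖ ≠ 0 := norm_ne_zero_iff.2 h1
  field_simp

/-- The conjugate mirror condition. -/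
theorem norm_sq_eval_daubechiesSymbol_add {N : ℕ} (hN : 1 ≤ N) {z : ℂ} (hz : ‖z‖ = 1) :
    ‖(daubechiesSymbol N).eval z‖ ^ 2 + ‖(daubechiesSymbol N).eval (-z)‖ ^ 2 = 1 := by
  rw [norm_sq_eval_daubechiesSymbol hN hz, norm_sq_eval_daubechiesSymbol hN (by simpa using hz),
    Complex.neg_re, sub_neg_eq_add, ← sub_eq_add_neg]
  exact daubechiesBezoutSum_identity hN (by ring)

/-- Exactly half of the `2(N - 1)` roots lie outside the circle, so the degree is at most `N + (N -
1)` and the `2N` filter coefficients are the whole symbol. -/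
theorem natDegree_daubechiesSymbol_lt {N : ℕ} (hN : 1 ≤ N) :
    (daubechiesSymbol N).natDegree < 2 * N := by
  classical
  have h1 : (daubechiesSpectralFactor N).natDegree ≤ N - 1 := by
    have h := congrArg Multiset.card (daubechiesProductPoly_roots_eq hN)
    rw [(roots_daubechiesProductPoly_inv hN).2, Multiset.card_add, Multiset.card_map] at h
    rw [daubechiesSpectralFactor, natDegree_multiset_prod_X_sub_C_eq_card]
    refine le_of_eq ?_
    convert (show (Multiset.filter (fun r => 1 < ‖r‖) (daubechiesProductPoly N).roots).card =
      N - 1 by omega)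
  have h2 : ((C (1 / 2 : ℂ) * (1 + X)) ^ N).natDegree ≤ N := by
    refine (natDegree_pow_le_of_le (m := 1) N ?_).trans (mul_one N).le
    exact (natDegree_C_mul_le _ _).trans ((natDegree_add_le _ _).trans (by simp))
  have h3 := natDegree_C_mul_le ((daubechiesSpectralFactor N).eval 1)⁻¹
    (daubechiesSpectralFactor N)
  have := natDegree_mul_le (p := (C (1 / 2 : ℂ) * (1 + X)) ^ N)
    (q := C ((daubechiesSpectralFactor N).eval 1)⁻¹ * daubechiesSpectralFactor N)
  rw [daubechiesSymbol]
  omega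

theorem map_conj_daubechiesSymbol (N : ℕ) :
    (daubechiesSymbol N).map (starRingEnd ℂ) = daubechiesSymbol N := by
  classical
  have hL : (daubechiesSpectralFactor N).map (starRingEnd ℂ) = daubechiesSpectralFactor N := by
    have h := daubechiesSpectralFactor_conj N
    rw [daubechiesSpectralFactor, Polynomial.map_multiset_prod, Multiset.map_map]
    conv_rhs => rw [← h, Multiset.map_map]
    simp
  have h1 : starRingEnd ℂ ((daubechiesSpectralFactor N).eval 1) =
      (daubechiesSpectralFactor N).eval 1 := by
    conv_rhs => rw [← hL, eval_map]
    rw [← eval₂_hom, map_one]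
  have h2 : ((starRingEnd ℂ) 2) = 2 := Complex.conj_ofNat 2
  simp [daubechiesSymbol, hL, h1, h2]

/-- The low-pass filter as the coefficient sequence of the symbol. -/
theorem eval_daubechiesSymbol_eq_sum {N : ℕ} (hN : 1 ≤ N) (z : ℂ) :
    (daubechiesSymbol N).eval z =
      ∑ l ∈ Finset.range (2 * N), ((daubechiesLowPass N l / √2 : ℝ) : ℂ) * z ^ l := by
  rw [eval_eq_sum_range' (natDegree_daubechiesSymbol_lt hN)]
  refine Finset.sum_congr rfl fun l _ => ?_
  congr 1
  have h : starRingEnd ℂ ((daubechiesSymbol N).coeff l) = (daubechiesSymbol N).coeff l := by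
    conv_rhs => rw [← map_conj_daubechiesSymbol, coeff_map]
  rw [daubechiesLowPass, mul_div_cancel_left₀ _ (by positivity), Complex.conj_eq_iff_re.1 h]

end SymbolAlgebra

/-! ### Fourier duality, uniqueness, inversion and Plancherel -/

theorem integral_fourier_mul_eq_integral_mul_fourier {f g : ℝ → ℂ} (hf : Integrable f)
    (hg : Integrable g) : ∫ ξ, 𝓕 f ξ * g ξ = ∫ x, f x * 𝓕 g x := by
  simpa using! VectorFourier.integral_bilin_fourierIntegral_eq_flip (.mul ℂ ℂ) (L := innerₗ ℝ)
    Real.continuous_fourierChar continuous_inner hf hg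

theorem integral_mul_fourierInv_eq {f g : ℝ → ℂ} (hf : Integrable f)
    (hg : Integrable g) : ∫ x, f x * 𝓕⁻ g x = ∫ ξ, 𝓕⁻ f ξ * g ξ := by
  rw [Real.fourierInv_eq_fourier_comp_neg g,
    ← integral_fourier_mul_eq_integral_mul_fourier hf hg.comp_neg,
    ← integral_neg_eq_self]
  simp [Real.fourierInv_eq_fourier_neg]

/-- Every test function is the Fourier transform of an integrable function. -/
theorem exists_schwartzMap_fourier_eq {g : ℝ → ℝ} (hg : ContDiff ℝ ∞ g)
    (hc : HasCompactSupport g) :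
    ∃ G : SchwartzMap ℝ ℂ, 𝓕 (G : ℝ → ℂ) = fun x => (g x : ℂ) := by
  have hc' : HasCompactSupport (fun x => (g x : ℂ)) := hc.comp_left Complex.ofReal_zero
  have hg' : ContDiff ℝ ∞ (fun x => (g x : ℂ)) := Complex.ofRealCLM.contDiff.comp hg
  refine ⟨𝓕⁻ (hc'.toSchwartzMap hg'), ?_⟩
  rw [← SchwartzMap.fourier_coe, FourierTransform.fourier_fourierInv_eq]
  rfl

theorem integral_smul_eq_integral_mul_fourier {f : ℝ → ℂ} (hf : Integrable f) {g : ℝ → ℝ}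
    {G : SchwartzMap ℝ ℂ} (hG : 𝓕 (G : ℝ → ℂ) = fun x => (g x : ℂ)) :
    ∫ x, g x • f x = ∫ ξ, G ξ * 𝓕 f ξ := by
  have h := integral_fourier_mul_eq_integral_mul_fourier G.integrable hf
  rw [hG] at h
  simpa using h

/-- Test functions are Fourier transforms of Schwartz functions, so by duality the pairing of `f`
with any of them depends only on `𝓕 f`. -/
theorem ae_eq_of_fourier_eq {f g : ℝ → ℂ} (hf : Integrable f) (hg : Integrable g)
    (h : 𝓕 f = 𝓕 g) : f =ᵐ[volume] g := by
  refine ae_eq_of_integral_contDiff_smul_eq hf.locallyIntegrable hg.locallyIntegrable ?_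
  intro u hu hc
  obtain ⟨G, hG⟩ := exists_schwartzMap_fourier_eq hu hc
  rw [integral_smul_eq_integral_mul_fourier hf hG, integral_smul_eq_integral_mul_fourier hg hG, h]

theorem continuous_fourier_of_integrable {f : ℝ → ℂ} (hf : Integrable f) : Continuous (𝓕 f) :=
  VectorFourier.fourierIntegral_continuous Real.continuous_fourierChar continuous_inner hf

theorem continuous_fourierInv_of_integrable {f : ℝ → ℂ} (hf : Integrable f) :
    Continuous (𝓕⁻ f) := by
  rw [Real.fourierInv_eq_fourier_comp_neg]
  exact continuous_fourier_of_integrable hf.comp_neg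

theorem norm_fourier_le_integral_norm (f : ℝ → ℂ) (ξ : ℝ) : ‖𝓕 f ξ‖ ≤ ∫ x, ‖f x‖ :=
  VectorFourier.norm_fourierIntegral_le_integral_norm _ _ _ _ _

theorem norm_fourierInv_le_integral_norm (f : ℝ → ℂ) (x : ℝ) : ‖𝓕⁻ f x‖ ≤ ∫ ξ, ‖f ξ‖ :=
  VectorFourier.norm_fourierIntegral_le_integral_norm _ _ _ _ _

theorem integral_smul_fourierInv_eq {h : ℝ → ℂ} (hh : Integrable h) {g : ℝ → ℝ}
    {G : SchwartzMap ℝ ℂ} (hG : 𝓕 (G : ℝ → ℂ) = fun x => (g x : ℂ)) :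
    ∫ x, g x • 𝓕⁻ h x = ∫ ξ, G ξ * h ξ := by
  have hG' : 𝓕⁻ (fun x => (g x : ℂ)) = G := by
    rw [← hG, ← SchwartzMap.fourier_coe, ← SchwartzMap.fourierInv_coe,
      FourierTransform.fourierInv_fourier_eq]
  have hg : Integrable (fun x => (g x : ℂ)) := by
    rw [← hG, ← SchwartzMap.fourier_coe]
    exact SchwartzMap.integrable _
  have := integral_mul_fourierInv_eq hg hh
  rw [hG'] at this
  simpa using this

/-- Same duality argument as for uniqueness; `f` need not be continuous, hence equality only a.e. -/
theorem ae_eq_fourierInv_fourier {f : ℝ → ℂ} (hf : Integrable f) (hf' : Integrable (𝓕 f)) :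
    f =ᵐ[volume] 𝓕⁻ (𝓕 f) := by
  refine ae_eq_of_integral_contDiff_smul_eq hf.locallyIntegrable
    (continuous_fourierInv_of_integrable hf').locallyIntegrable ?_
  intro u hu hc
  obtain ⟨G, hG⟩ := exists_schwartzMap_fourier_eq hu hc
  rw [integral_smul_eq_integral_mul_fourier hf hG, integral_smul_fourierInv_eq hf' hG]

theorem fourier_conj_eq (f : ℝ → ℂ) (x : ℝ) :
    𝓕 (fun ξ => starRingEnd ℂ (f ξ)) x = starRingEnd ℂ (𝓕⁻ f x) := by
  rw [Real.fourier_eq', Real.fourierInv_eq', ← integral_conj]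
  congr 1 with ξ
  simp [← Complex.exp_conj, show (starRingEnd ℂ) 2 = 2 from Complex.conj_ofNat 2]

/-- Plancherel's identity for an integrable function with integrable Fourier transform. -/
theorem integral_norm_sq_fourier_eq {f : ℝ → ℂ} (hf : Integrable f) (hf' : Integrable (𝓕 f)) :
    ∫ ξ, ‖𝓕 f ξ‖ ^ 2 = ∫ x, ‖f x‖ ^ 2 := by
  have hc : Integrable (fun ξ => starRingEnd ℂ (𝓕 f ξ)) :=
    (LinearIsometryEquiv.integrable_comp_iff Complex.conjLIE).2 hf'
  have h1 := integral_fourier_mul_eq_integral_mul_fourier hf hc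
  have h2 : ∫ x, f x * 𝓕 (fun ξ => starRingEnd ℂ (𝓕 f ξ)) x =
      ∫ x, f x * starRingEnd ℂ (f x) := by
    refine integral_congr_ae ?_
    filter_upwards [ae_eq_fourierInv_fourier hf hf'] with x hx
    rw [fourier_conj_eq, ← hx]
  rw [h2] at h1
  simp only [Complex.mul_conj, Complex.normSq_eq_norm_sq] at h1
  rw [integral_complex_ofReal, integral_complex_ofReal] at h1
  exact_mod_cast h1

/-! ### Masks and the subdivision operator -/

/-- The trigonometric polynomial `∑_{l < M} c_l e^{-2πi l x}`. -/
noncomputable def filterMask (c : ℕ → ℝ) (M : ℕ) (x : ℝ) : ℂ :=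
  ∑ l ∈ Finset.range M, (c l : ℂ) * Complex.exp (-2 * Real.pi * x * Complex.I) ^ l

/-- The subdivision operator `f ↦ 2 ∑_{l < M} c_l f(2t - l)`. -/
noncomputable def subdivision (c : ℕ → ℝ) (M : ℕ) (f : ℝ → ℂ) (t : ℝ) : ℂ :=
  2 * ∑ l ∈ Finset.range M, (c l : ℂ) * f (2 * t - l)

theorem integrable_comp_two_mul_sub {f : ℝ → ℂ} (hf : Integrable f) (a : ℝ) :
    Integrable fun t => f (2 * t - a) :=
  (hf.comp_sub_right a).comp_mul_left' two_ne_zero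

theorem integrable_subdivision (c : ℕ → ℝ) (M : ℕ) {f : ℝ → ℂ} (hf : Integrable f) :
    Integrable (subdivision c M f) :=
  (integrable_finsetSum _ fun _ _ => (integrable_comp_two_mul_sub hf _).const_mul _).const_mul _

theorem fourier_comp_two_mul_sub (f : ℝ → ℂ) (a w : ℝ) :
    𝓕 (fun t => f (2 * t - a)) w =
      1 / 2 * (Complex.exp (-2 * Real.pi * (w / 2 : ℝ) * a * Complex.I) * 𝓕 f (w / 2)) := by
  rw [Real.fourier_real_eq_integral_exp_smul, Real.fourier_real_eq_integral_exp_smul]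
  let F : ℝ → ℂ := fun u => Complex.exp (-2 * Real.pi * (w / 2 : ℝ) * a * Complex.I) *
    (Complex.exp ((-2 * Real.pi * u * (w / 2) : ℝ) * Complex.I) • f u)
  have h1 : ∀ t : ℝ, Complex.exp ((-2 * Real.pi * t * w : ℝ) * Complex.I) • f (2 * t - a) =
      (fun v => F (v - a)) (2 * t) := by
    intro t
    simp only [F, smul_eq_mul]
    rw [← mul_assoc, ← Complex.exp_add]
    congr 2
    push_cast
    ring
  rw [integral_congr_ae (Eventually.of_forall h1),
    Measure.integral_comp_mul_left (fun v => F (v - a)) 2, integral_sub_right_eq_self F a, integral_const_mul]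
  rw [Complex.real_smul]
  norm_num

theorem fourier_subdivision (c : ℕ → ℝ) (M : ℕ) {f : ℝ → ℂ} (hf : Integrable f) (w : ℝ) :
    𝓕 (subdivision c M f) w = filterMask c M (w / 2) * 𝓕 f (w / 2) := by
  have h : 𝓕 (subdivision c M f) w =
      2 * ∑ l ∈ Finset.range M, (c l : ℂ) * 𝓕 (fun t => f (2 * t - l)) w := by
    simp only [Real.fourier_real_eq_integral_exp_smul, smul_eq_mul]
    simp_rw [← integral_const_mul]
    rw [← integral_finsetSum, ← integral_const_mul]
    · congr 1 with t
      simp only [subdivision, Finset.mul_sum]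
      refine Finset.sum_congr rfl fun l _ => ?_
      ring
    · intro l _
      refine Integrable.const_mul ?_ _
      have := (Real.fourierIntegral_convergent_iff (μ := volume) w).2
        (integrable_comp_two_mul_sub hf (l : ℝ))
      refine this.congr (Eventually.of_forall fun t => ?_)
      simp only [Circle.smul_def, Real.fourierChar_apply, smul_eq_mul]
      congr 3
      simp
      ring
  rw [h, filterMask, Finset.mul_sum, Finset.sum_mul]
  refine Finset.sum_congr rfl fun l _ => ?_
  rw [fourier_comp_two_mul_sub, ← Complex.exp_nat_mul]
  push_cast
  rw [show (l : ℂ) * (-2 * Real.pi * (w / 2) * Complex.I) =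
    -2 * Real.pi * (w / 2) * l * Complex.I by ring]
  ring

/-! ### Infinite products of conjugate mirror masks -/

/-- A Lipschitz, `1`-periodic low-pass mask satisfying the conjugate mirror condition. -/
structure IsConjugateMirrorMask (m : ℝ → ℂ) : Prop where
  continuous : Continuous m
  periodic : Function.Periodic m 1
  map_zero : m 0 = 1
  mirror : ∀ x, ‖m x‖ ^ 2 + ‖m (x + 1 / 2)‖ ^ 2 = 1
  lipschitz : ∃ K, ∀ x, ‖m x - 1‖ ≤ K * |x|

/-- The truncated product `∏_{j = 1}^n m(w / 2^j)`. -/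
noncomputable def maskPartialProd (m : ℝ → ℂ) (n : ℕ) (w : ℝ) : ℂ :=
  ∏ j ∈ Finset.range n, m (w / 2 ^ (j + 1))

/-- The infinite product `∏_{j ≥ 1} m(w / 2^j)`. -/
noncomputable def maskProd (m : ℝ → ℂ) (w : ℝ) : ℂ :=
  limUnder atTop fun n => maskPartialProd m n w

theorem maskPartialProd_succ (m : ℝ → ℂ) (n : ℕ) (w : ℝ) :
    maskPartialProd m (n + 1) w = maskPartialProd m n w * m (w / 2 ^ (n + 1)) :=
  Finset.prod_range_succ _ _

theorem maskPartialProd_succ' (m : ℝ → ℂ) (n : ℕ) (w : ℝ) :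
    maskPartialProd m (n + 1) w = m (w / 2) * maskPartialProd m n (w / 2) := by
  rw [maskPartialProd, Finset.prod_range_succ', mul_comm]
  congr 1
  · simp
  · refine Finset.prod_congr rfl fun j _ => ?_
    rw [div_div, ← pow_succ']

namespace IsConjugateMirrorMask

variable {m : ℝ → ℂ}

theorem norm_le_one (hm : IsConjugateMirrorMask m) (x : ℝ) : ‖m x‖ ≤ 1 := by
  have := hm.mirror x
  nlinarith [sq_nonneg ‖m (x + 1 / 2)‖, norm_nonneg (m x)]

theorem norm_maskPartialProd_le_one (hm : IsConjugateMirrorMask m) (n : ℕ) (w : ℝ) :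
    ‖maskPartialProd m n w‖ ≤ 1 := by
  rw [maskPartialProd, norm_prod]
  exact Finset.prod_le_one (fun _ _ => norm_nonneg _) fun _ _ => hm.norm_le_one _

theorem continuous_maskPartialProd (hm : IsConjugateMirrorMask m) (n : ℕ) :
    Continuous (maskPartialProd m n) :=
  continuous_finsetProd _ fun _ _ => hm.continuous.comp (continuous_id.div_const _)

theorem periodic_maskPartialProd (hm : IsConjugateMirrorMask m) (n : ℕ) :
    Function.Periodic (maskPartialProd m n) (2 ^ n) := by
  intro w
  refine Finset.prod_congr rfl fun j hj => ?_
  obtain ⟨k, hk⟩ := Nat.exists_eq_add_of_le (Nat.succ_le_of_lt (Finset.mem_range.1 hj))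
  have h := (hm.periodic.nat_mul (2 ^ k)) (w / 2 ^ (j + 1))
  rw [← h, add_div, hk, show j.succ = j + 1 from rfl, pow_add (2 : ℝ) (j + 1) k]
  congr 2
  push_cast
  field_simp

/-- The integral of `‖∏_{j ≤ n} m(w / 2^j)‖²` over a period is one. -/
theorem integral_norm_sq_maskPartialProd (hm : IsConjugateMirrorMask m) (n : ℕ) :
    ∫ w in (0 : ℝ)..2 ^ n, ‖maskPartialProd m n w‖ ^ 2 = 1 := by
  induction n with
  | zero => simp [maskPartialProd]
  | succ n ih =>
    have hi : ∀ a b : ℝ, IntervalIntegrable (fun w => ‖maskPartialProd m (n + 1) w‖ ^ 2)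
        volume a b := fun a b =>
      ((hm.continuous_maskPartialProd (n + 1)).norm.pow 2).intervalIntegrable a b
    have hi2 : IntervalIntegrable (fun w => ‖maskPartialProd m (n + 1) (w + 2 ^ n)‖ ^ 2)
        volume 0 (2 ^ n) :=
      (((hm.continuous_maskPartialProd (n + 1)).comp
        (continuous_add_const _)).norm.pow 2).intervalIntegrable _ _
    rw [← intervalIntegral.integral_add_adjacent_intervals (hi 0 (2 ^ n)) (hi _ _)]
    have hshift : ∫ w in (2 ^ n : ℝ)..2 ^ (n + 1), ‖maskPartialProd m (n + 1) w‖ ^ 2 =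
        ∫ w in (0 : ℝ)..2 ^ n, ‖maskPartialProd m (n + 1) (w + 2 ^ n)‖ ^ 2 := by
      rw [intervalIntegral.integral_comp_add_right
        (fun w => ‖maskPartialProd m (n + 1) w‖ ^ 2)]
      congr 1 <;> ring
    rw [hshift, ← intervalIntegral.integral_add (hi _ _) hi2, ← ih]
    refine intervalIntegral.integral_congr fun w _ => ?_
    -- A shift by `2^n` is a period of the first `n` factors and half a period of the last one, so
    -- the mirror condition removes the last factor.
    have h1 := hm.mirror (w / 2 ^ (n + 1))
    have h2 : (w + 2 ^ n) / 2 ^ (n + 1) = w / 2 ^ (n + 1) + 1 / 2 := by field_simp; ring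
    simp only [maskPartialProd_succ, hm.periodic_maskPartialProd n w, norm_mul, mul_pow, h2]
    linear_combination ‖maskPartialProd m n w‖ ^ 2 * h1

/-- The earlier factors have norm at most one and the new one is within `K |w| / 2^(n+1)` of `1`:
the convergence is geometric, uniformly for bounded `w`. -/
theorem exists_dist_maskPartialProd_le (hm : IsConjugateMirrorMask m) :
    ∃ K, ∀ n w, dist (maskPartialProd m n w) (maskPartialProd m (n + 1) w) ≤
      K * |w| / 2 / 2 ^ n := by
  obtain ⟨K, hK⟩ := hm.lipschitz
  refine ⟨K, fun n w => ?_⟩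
  rw [dist_eq_norm, maskPartialProd_succ, ← norm_neg,
    show -(maskPartialProd m n w - maskPartialProd m n w * m (w / 2 ^ (n + 1))) =
      maskPartialProd m n w * (m (w / 2 ^ (n + 1)) - 1) by ring, norm_mul]
  calc _ ≤ 1 * (K * |w / 2 ^ (n + 1)|) :=
        mul_le_mul (hm.norm_maskPartialProd_le_one n w) (hK _) (norm_nonneg _) zero_le_one
    _ = _ := by
      rw [abs_div, abs_of_pos (show (0 : ℝ) < 2 ^ (n + 1) by positivity), pow_succ]
      field_simp

theorem tendsto_maskPartialProd (hm : IsConjugateMirrorMask m) (w : ℝ) :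
    Tendsto (fun n => maskPartialProd m n w) atTop (𝓝 (maskProd m w)) := by
  obtain ⟨K, hK⟩ := hm.exists_dist_maskPartialProd_le
  exact (cauchySeq_of_le_geometric_two fun n => hK n w).tendsto_limUnder

theorem continuous_maskProd (hm : IsConjugateMirrorMask m) : Continuous (maskProd m) := by
  obtain ⟨K, hK⟩ := hm.exists_dist_maskPartialProd_le
  have hK0 : 0 ≤ K := by
    have := dist_nonneg.trans (hK 0 1)
    simp at this
    linarith
  refine TendstoLocallyUniformly.continuous (F := maskPartialProd m) (p := atTop) ?_
    (Frequently.of_forall hm.continuous_maskPartialProd)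
  rw [Metric.tendstoLocallyUniformly_iff]
  intro ε hε w
  refine ⟨Metric.ball w 1, Metric.ball_mem_nhds w one_pos, ?_⟩
  have hlim : Tendsto (fun n : ℕ => K * (|w| + 1) * (1 / 2 : ℝ) ^ n) atTop (𝓝 0) := by
    simpa using (tendsto_pow_atTop_nhds_zero_of_lt_one (r := (1 / 2 : ℝ)) (by norm_num)
      (by norm_num)).const_mul (K * (|w| + 1))
  filter_upwards [hlim.eventually_lt_const hε] with n hn y hy
  have h := dist_le_of_le_geometric_two_of_tendsto (fun n => hK n y)
    (hm.tendsto_maskPartialProd y) n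
  rw [dist_comm]
  refine h.trans_lt (lt_of_le_of_lt ?_ hn)
  have hy' : |y| ≤ |w| + 1 := by
    have h1 : |y - w| < 1 := by simpa [Real.dist_eq] using hy
    have := abs_sub_abs_le_abs_sub y w
    linarith
  rw [one_div, inv_pow, ← div_eq_mul_inv]
  gcongr

theorem maskProd_two_scale (hm : IsConjugateMirrorMask m) (w : ℝ) :
    maskProd m w = m (w / 2) * maskProd m (w / 2) := by
  refine tendsto_nhds_unique ((tendsto_add_atTop_iff_nat 1).2 (hm.tendsto_maskPartialProd w)) ?_
  simp only [maskPartialProd_succ']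
  exact (hm.tendsto_maskPartialProd (w / 2)).const_mul _

theorem maskProd_zero (hm : IsConjugateMirrorMask m) : maskProd m 0 = 1 := by
  refine tendsto_nhds_unique (hm.tendsto_maskPartialProd 0) ?_
  simp [maskPartialProd, hm.map_zero]

theorem norm_maskProd_le (hm : IsConjugateMirrorMask m) (n : ℕ) (w : ℝ) :
    ‖maskProd m w‖ ≤ ‖maskPartialProd m n w‖ := by
  refine le_of_tendsto (hm.tendsto_maskPartialProd w).norm ?_
  filter_upwards [eventually_ge_atTop n] with k hk
  induction k, hk using Nat.le_induction with
  | base => exact le_rfl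
  | succ k _ ih =>
    rw [maskPartialProd_succ, norm_mul]
    exact (mul_le_of_le_one_right (norm_nonneg _) (hm.norm_le_one _)).trans ih

theorem norm_maskProd_le_one (hm : IsConjugateMirrorMask m) (w : ℝ) : ‖maskProd m w‖ ≤ 1 :=
  (hm.norm_maskProd_le 0 w).trans (hm.norm_maskPartialProd_le_one 0 w)

/-- On `[-2^n, 2^n]`, a full period of the partial product of length `n + 1`, that product dominates
`maskProd` and has square integral one; then `n → ∞`. -/
theorem integral_norm_sq_maskProd_le_one (hm : IsConjugateMirrorMask m)
    (hi : Integrable fun w => ‖maskProd m w‖ ^ 2) : ∫ w, ‖maskProd m w‖ ^ 2 ≤ 1 := by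
  have ht : Tendsto (fun n : ℕ => (2 : ℝ) ^ n) atTop atTop :=
    tendsto_pow_atTop_atTop_of_one_lt one_lt_two
  refine le_of_tendsto (intervalIntegral_tendsto_integral hi (tendsto_neg_atTop_atBot.comp ht) ht)
    (Eventually.of_forall fun n => ?_)
  have hp : Function.Periodic (fun w => ‖maskPartialProd m (n + 1) w‖ ^ 2) (2 ^ (n + 1)) :=
    fun w => by simp only [hm.periodic_maskPartialProd (n + 1) w]
  have h := hp.intervalIntegral_add_eq (-2 ^ n) 0
  rw [zero_add, hm.integral_norm_sq_maskPartialProd,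
    show (-2 ^ n : ℝ) + 2 ^ (n + 1) = 2 ^ n by ring] at h
  rw [← h]
  refine intervalIntegral.integral_mono_on ?_ hi.intervalIntegrable
    (((hm.continuous_maskPartialProd (n + 1)).norm.pow 2).intervalIntegrable _ _) ?_
  · have : (0 : ℝ) < 2 ^ n := by positivity
    simp only [Function.comp_apply]
    linarith
  · intro w _
    have := hm.norm_maskProd_le (n + 1) w
    gcongr

/-- The infinite product is the only solution of the two-scale equation. -/
theorem eq_maskProd_of_two_scale (hm : IsConjugateMirrorMask m) {F : ℝ → ℂ}
    (hF : ContinuousAt F 0) (h0 : F 0 = 1) (h : ∀ w, F w = m (w / 2) * F (w / 2)) :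
    F = maskProd m := by
  funext w
  have hn : ∀ n w, F w = maskPartialProd m n w * F (w / 2 ^ n) := by
    intro n
    induction n with
    | zero => intro w; simp [maskPartialProd]
    | succ n ih =>
      intro w
      rw [h w, ih (w / 2), maskPartialProd_succ', div_div, ← pow_succ', mul_assoc]
  have hw : Tendsto (fun n : ℕ => w / 2 ^ n) atTop (𝓝 0) :=
    tendsto_const_nhds.div_atTop (tendsto_pow_atTop_atTop_of_one_lt one_lt_two)
  have := (hm.tendsto_maskPartialProd w).mul (hF.tendsto.comp hw)
  rw [h0, mul_one] at this
  refine tendsto_nhds_unique (Tendsto.congr (fun n => ?_) tendsto_const_nhds) this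
  exact hn n w

/-- The cosine factors telescope by the double-angle formula: `sin(πw) = 2^n sin(πw / 2^n) ∏ cos(πw
/ 2^j)`. -/
theorem norm_maskPartialProd_mul_le {B : ℝ} {N : ℕ} (hB : 0 ≤ B)
    (hbound : ∀ x, ‖m x‖ ≤ |Real.cos (Real.pi * x)| ^ N * B) (n : ℕ) (w : ℝ) :
    ‖maskPartialProd m n w‖ * |2 ^ n * Real.sin (Real.pi * (w / 2 ^ n))| ^ N ≤ B ^ n := by
  have key : ‖maskPartialProd m n w‖ * |2 ^ n * Real.sin (Real.pi * (w / 2 ^ n))| ^ N ≤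
      |Real.sin (Real.pi * w)| ^ N * B ^ n := by
    induction n with
    | zero => simp [maskPartialProd]
    | succ n ih =>
      have h2 : (2 : ℝ) ^ n * Real.sin (Real.pi * (w / 2 ^ n)) =
          2 ^ (n + 1) * Real.sin (Real.pi * (w / 2 ^ (n + 1))) *
            Real.cos (Real.pi * (w / 2 ^ (n + 1))) := by
        rw [show Real.pi * (w / 2 ^ n) = 2 * (Real.pi * (w / 2 ^ (n + 1))) by
          rw [pow_succ]; field_simp, Real.sin_two_mul]
        ring
      rw [h2, abs_mul, mul_pow] at ih
      rw [maskPartialProd_succ, norm_mul]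
      set a := |2 ^ (n + 1) * Real.sin (Real.pi * (w / 2 ^ (n + 1)))| ^ N
      have ha : 0 ≤ a := by positivity
      calc ‖maskPartialProd m n w‖ * ‖m (w / 2 ^ (n + 1))‖ * a
          ≤ ‖maskPartialProd m n w‖ *
            (|Real.cos (Real.pi * (w / 2 ^ (n + 1)))| ^ N * B) * a := by
            gcongr
            exact hbound _
        _ = ‖maskPartialProd m n w‖ *
            (a * |Real.cos (Real.pi * (w / 2 ^ (n + 1)))| ^ N) * B := by ring
        _ ≤ |Real.sin (Real.pi * w)| ^ N * B ^ n * B := by gcongr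
        _ = _ := by ring
  refine key.trans (mul_le_of_le_one_left (by positivity) ?_)
  exact pow_le_one₀ (abs_nonneg _) (Real.abs_sin_le_one _)

/-- Polynomial decay of the infinite product. -/
theorem exists_norm_maskProd_le (hm : IsConjugateMirrorMask m) {B : ℝ} {N : ℕ}
    (hbound : ∀ x, ‖m x‖ ≤ |Real.cos (Real.pi * x)| ^ N * B) (hB : B < 2 ^ N / 2) :
    ∃ C r : ℝ, 1 < r ∧ ∀ w, ‖maskProd m w‖ ≤ C * (1 + ‖w‖) ^ (-r) := by
  have hB1 : 1 ≤ B := by simpa [hm.map_zero] using hbound 0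
  -- `q` is the gain per dyadic scale; `q < 1/2` says exactly that the decay exponent `r = -log₂ q`
  -- exceeds `1`.
  set q : ℝ := B / 2 ^ N with hq
  have hq0 : 0 < q := by positivity
  have hq1 : q < 1 / 2 := by
    rw [hq, div_lt_iff₀ (by positivity)]
    linarith
  set r : ℝ := -Real.logb 2 q with hr
  have hqr : q = 2 ^ (-r) := by
    rw [hr, neg_neg, Real.rpow_logb (by norm_num) (by norm_num) hq0]
  have hr1 : 1 < r := by
    have : Real.logb 2 q < Real.logb 2 (1 / 2) :=
      Real.logb_lt_logb (by norm_num) hq0 hq1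
    rw [one_div, Real.logb_inv, Real.logb_self_eq_one (by norm_num)] at this
    linarith
  have hpow : ∀ (J : ℕ) (w : ℝ), |w| ≤ 2 ^ J → q ^ J ≤ 2 ^ r * (1 + ‖w‖) ^ (-r) := by
    intro J w hw
    have h1 : ((2 : ℝ) ^ (J + 1)) ^ (-r) ≤ (1 + ‖w‖) ^ (-r) := by
      refine Real.rpow_le_rpow_of_nonpos (by positivity) ?_ (by linarith)
      have : (1 : ℝ) ≤ 2 ^ J := one_le_pow₀ (by norm_num)
      rw [Real.norm_eq_abs, pow_succ]
      linarith
    calc q ^ J = 2 ^ r * ((2 : ℝ) ^ (J + 1)) ^ (-r) := by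
          rw [hqr, ← Real.rpow_natCast, ← Real.rpow_natCast, ← Real.rpow_mul (by norm_num),
            ← Real.rpow_mul (by norm_num), ← Real.rpow_add (by norm_num)]
          congr 1
          push_cast
          ring
      _ ≤ _ := by gcongr
  refine ⟨2 ^ N * 2 ^ r, r, hr1, fun w => ?_⟩
  have h2N : (1 : ℝ) ≤ 2 ^ N := one_le_pow₀ (by norm_num)
  rcases lt_or_ge (4 * |w|) 1 with hw | hw
  · have h := hpow 0 w (by rw [pow_zero]; linarith)
    rw [pow_zero] at h
    have h1 := hm.norm_maskProd_le_one w
    rw [mul_assoc]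
    nlinarith
  -- With `2^J ≤ 4|w| < 2^(J+1)`, the point `|w| / 2^J` lies in `[1/4, 1/2)`, where Jordan's
  -- inequality gives a sine of at least `1/2`.
  · obtain ⟨J, hJ1, hJ2⟩ := exists_nat_pow_near hw (one_lt_two (α := ℝ))
    have h2J : (0 : ℝ) < 2 ^ J := by positivity
    have hsin : 1 / 2 ≤ |Real.sin (Real.pi * (w / 2 ^ J))| := by
      have hu1 : 1 / 4 ≤ |w| / 2 ^ J := by rw [le_div_iff₀ h2J]; linarith
      have hu2 : |w| / 2 ^ J ≤ 1 / 2 := by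
        rw [div_le_iff₀ h2J]
        rw [pow_succ] at hJ2
        linarith
      have h3 : |Real.sin (Real.pi * (w / 2 ^ J))| = |Real.sin (Real.pi * (|w| / 2 ^ J))| := by
        rcases abs_choice w with h | h <;> rw [h]
        rw [neg_div, mul_neg, Real.sin_neg, abs_neg]
      have hpi := Real.pi_pos
      rw [h3]
      refine le_trans ?_ (le_abs_self _)
      refine le_trans ?_ (Real.mul_le_sin (by positivity) (by nlinarith))
      rw [← mul_assoc, div_mul_cancel₀ _ hpi.ne']
      linarith
    have h4 := norm_maskPartialProd_mul_le (zero_le_one.trans hB1) hbound J w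
    have h5 : ‖maskProd m w‖ ≤ 2 ^ N * q ^ J := by
      have h6 : ((2 : ℝ) ^ J * (1 / 2)) ^ N ≤
          |2 ^ J * Real.sin (Real.pi * (w / 2 ^ J))| ^ N := by
        rw [abs_mul, abs_of_pos h2J]
        gcongr
      have h7 : ‖maskProd m w‖ * ((2 : ℝ) ^ J * (1 / 2)) ^ N ≤ B ^ J :=
        (mul_le_mul (hm.norm_maskProd_le J w) h6 (by positivity) (norm_nonneg _)).trans h4
      rw [← le_div_iff₀ (by positivity)] at h7
      refine h7.trans (le_of_eq ?_)
      rw [hq, div_pow, mul_pow, one_div, inv_pow, ← pow_mul, ← pow_mul, mul_comm J N]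
      field_simp
    refine h5.trans ?_
    rw [mul_assoc]
    gcongr
    refine hpow J w ?_
    rw [pow_succ] at hJ2
    linarith

theorem integrable_maskProd (hm : IsConjugateMirrorMask m) {B : ℝ} {N : ℕ}
    (hbound : ∀ x, ‖m x‖ ≤ |Real.cos (Real.pi * x)| ^ N * B) (hB : B < 2 ^ N / 2) :
    Integrable (maskProd m) := by
  obtain ⟨C, r, hr, h⟩ := hm.exists_norm_maskProd_le hbound hB
  refine ((integrable_one_add_norm (μ := volume) (E := ℝ) (r := r) (by simpa)).const_mul C).mono'
    hm.continuous_maskProd.aestronglyMeasurable (Eventually.of_forall h)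

theorem integrable_norm_sq_maskProd (hm : IsConjugateMirrorMask m)
    (hi : Integrable (maskProd m)) : Integrable fun w => ‖maskProd m w‖ ^ 2 := by
  refine hi.norm.mono' (hm.continuous_maskProd.norm.pow 2).aestronglyMeasurable
    (Eventually.of_forall fun w => ?_)
  rw [Real.norm_of_nonneg (by positivity)]
  exact pow_le_of_le_one (norm_nonneg _) (hm.norm_maskProd_le_one w) two_ne_zero

end IsConjugateMirrorMask

/-! ### Trigonometric masks and the Daubechies filter -/

theorem ae_comp_two_mul_sub {p : ℝ → Prop} (h : ∀ᵐ x : ℝ, p x) (a : ℝ) :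
    ∀ᵐ t : ℝ, p (2 * t - a) := by
  have h1 : Measure.QuasiMeasurePreserving (fun t : ℝ => 2 * t) volume volume := by
    refine ⟨measurable_const_mul 2, ?_⟩
    rw [Real.map_volume_mul_left two_ne_zero]
    exact Measure.smul_absolutelyContinuous
  exact h1.ae ((measurePreserving_sub_right volume a).quasiMeasurePreserving.ae h)

theorem norm_exp_neg_two_pi_mul (x : ℝ) :
    ‖Complex.exp (-2 * Real.pi * x * Complex.I)‖ = 1 := by
  rw [show (-2 * Real.pi * x * Complex.I : ℂ) = ((-2 * Real.pi * x : ℝ) : ℂ) * Complex.I by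
    push_cast; ring]
  exact Complex.norm_exp_ofReal_mul_I _

theorem exp_neg_two_pi_mul_add_half (x : ℝ) :
    Complex.exp (-2 * Real.pi * ((x + 1 / 2 : ℝ) : ℂ) * Complex.I) =
      -Complex.exp (-2 * Real.pi * x * Complex.I) := by
  rw [show (-2 * Real.pi * ((x + 1 / 2 : ℝ) : ℂ) * Complex.I : ℂ) =
    -2 * Real.pi * x * Complex.I - Real.pi * Complex.I by push_cast; ring, Complex.exp_sub,
    Complex.exp_pi_mul_I, div_neg, div_one]

theorem continuous_filterMask (c : ℕ → ℝ) (M : ℕ) : Continuous (filterMask c M) := by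
  unfold filterMask
  fun_prop

theorem periodic_filterMask (c : ℕ → ℝ) (M : ℕ) : Function.Periodic (filterMask c M) 1 := by
  intro x
  have h := exp_neg_two_pi_mul_add_half (x + 1 / 2)
  rw [exp_neg_two_pi_mul_add_half x, neg_neg, show x + 1 / 2 + 1 / 2 = x + 1 by ring] at h
  simp only [filterMask, h]

theorem norm_filterMask_sub_le (c : ℕ → ℝ) (M : ℕ) (x : ℝ) :
    ‖filterMask c M x - filterMask c M 0‖ ≤
      (∑ l ∈ Finset.range M, |c l| * (2 * Real.pi * l)) * |x| := by
  rw [filterMask, filterMask, ← Finset.sum_sub_distrib, Finset.sum_mul]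
  refine norm_sum_le_of_le _ fun l _ => ?_
  rw [← mul_sub, norm_mul, Complex.norm_real, Real.norm_eq_abs, mul_assoc |c l|]
  refine mul_le_mul_of_nonneg_left ?_ (abs_nonneg (c l))
  rw [← Complex.exp_nat_mul, ← Complex.exp_nat_mul,
    show (l * (-2 * Real.pi * x * Complex.I) : ℂ) =
      Complex.I * ((-(2 * Real.pi * l * x) : ℝ) : ℂ) by push_cast; ring]
  have h := Real.norm_exp_I_mul_ofReal_sub_one_le (x := -(2 * Real.pi * l * x))
  simpa [abs_mul, abs_of_pos Real.pi_pos] using h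

theorem conj_filterMask (c : ℕ → ℝ) (M : ℕ) (x : ℝ) :
    starRingEnd ℂ (filterMask c M x) = filterMask c M (-x) := by
  simp [filterMask, ← Complex.exp_conj, show (starRingEnd ℂ) 2 = 2 from Complex.conj_ofNat 2]

theorem conj_maskProd {c : ℕ → ℝ} {M : ℕ} (hm : IsConjugateMirrorMask (filterMask c M)) (w : ℝ) :
    starRingEnd ℂ (maskProd (filterMask c M) w) = maskProd (filterMask c M) (-w) := by
  refine tendsto_nhds_unique ((Complex.continuous_conj.tendsto _).comp
    (hm.tendsto_maskPartialProd w)) ?_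
  refine (hm.tendsto_maskPartialProd (-w)).congr fun n => ?_
  simp only [Function.comp_apply, maskPartialProd, map_prod, conj_filterMask, neg_div]

/-- The mask of the alternating flip is the mask shifted by half a period, up to a phase. -/
theorem norm_filterMask_alternatingFlip (c : ℕ → ℝ) (M : ℕ) (x : ℝ) :
    ‖filterMask (fun l => (-1) ^ l * c (M - 1 - l)) M x‖ = ‖filterMask c M (x + 1 / 2)‖ := by
  simp only [filterMask, exp_neg_two_pi_mul_add_half]
  set z : ℂ := -Complex.exp (-2 * Real.pi * x * Complex.I) with hz
  have hz1 : ‖z‖ = 1 := by rw [hz, norm_neg, norm_exp_neg_two_pi_mul]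
  have hzz : z * starRingEnd ℂ z = 1 := by
    rw [Complex.mul_conj, Complex.normSq_eq_norm_sq, hz1]
    simp
  have h1 : ∑ l ∈ Finset.range M, (((-1) ^ l * c (M - 1 - l) : ℝ) : ℂ) *
      Complex.exp (-2 * Real.pi * x * Complex.I) ^ l =
      z ^ (M - 1) * starRingEnd ℂ (∑ l ∈ Finset.range M, (c l : ℂ) * z ^ l) := by
    rw [← Finset.sum_range_reflect, map_sum, Finset.mul_sum]
    refine Finset.sum_congr rfl fun l hl => ?_
    have hl := Finset.mem_range.1 hl
    rw [show M - 1 - (M - 1 - l) = l by omega,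
      show z ^ (M - 1) = z ^ (M - 1 - l) * z ^ l by rw [← pow_add]; congr 1; omega]
    simp only [map_mul, map_pow, Complex.conj_ofReal]
    rw [show z ^ (M - 1 - l) * z ^ l * (c l * starRingEnd ℂ z ^ l) =
      z ^ (M - 1 - l) * c l * (z * starRingEnd ℂ z) ^ l by ring, hzz, hz, neg_pow]
    push_cast
    ring
  rw [h1, norm_mul, norm_pow, hz1, one_pow, one_mul, RCLike.norm_conj]

/-- The normalised coefficients of the low-pass filter. -/
noncomputable def daubechiesCoeff (N l : ℕ) : ℝ := daubechiesLowPass N l / √2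

theorem filterMask_daubechiesCoeff {N : ℕ} (hN : 1 ≤ N) (x : ℝ) :
    filterMask (daubechiesCoeff N) (2 * N) x =
      (daubechiesSymbol N).eval (Complex.exp (-2 * Real.pi * x * Complex.I)) :=
  (eval_daubechiesSymbol_eq_sum hN _).symm

theorem isConjugateMirrorMask_daubechies {N : ℕ} (hN : 1 ≤ N) :
    IsConjugateMirrorMask (filterMask (daubechiesCoeff N) (2 * N)) := by
  have h0 : filterMask (daubechiesCoeff N) (2 * N) 0 = 1 := by
    rw [filterMask_daubechiesCoeff hN]
    simpa using eval_one_daubechiesSymbol hN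
  refine ⟨continuous_filterMask _ _, periodic_filterMask _ _, h0, fun x => ?_,
    _, fun x => h0 ▸ norm_filterMask_sub_le _ _ x⟩
  rw [filterMask_daubechiesCoeff hN, filterMask_daubechiesCoeff hN, exp_neg_two_pi_mul_add_half]
  exact norm_sq_eval_daubechiesSymbol_add hN (norm_exp_neg_two_pi_mul x)

/-- The factor `((1 + z) / 2)^N` has modulus `|cos πx|^N`; the rest is `√(P_N(sin² πx))`, largest
when the argument is `1`. -/
theorem norm_filterMask_daubechies_le {N : ℕ} (hN : 1 ≤ N) (x : ℝ) :
    ‖filterMask (daubechiesCoeff N) (2 * N) x‖ ≤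
      |Real.cos (Real.pi * x)| ^ N * √(daubechiesBezoutSum N 1) := by
  have hP : 0 ≤ daubechiesBezoutSum N (1 : ℝ) :=
    zero_le_one.trans (one_le_daubechiesBezoutSum hN zero_le_one)
  have hre : (Complex.exp (-2 * Real.pi * x * Complex.I)).re = 2 * Real.cos (Real.pi * x) ^ 2 - 1 := by
    rw [show (-2 * Real.pi * x * Complex.I : ℂ) = ((-(2 * (Real.pi * x)) : ℝ) : ℂ) * Complex.I by
      push_cast; ring, Complex.exp_ofReal_mul_I_re, Real.cos_neg, Real.cos_two_mul]
  refine abs_le_of_sq_le_sq' ?_ (by positivity) |>.2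
  rw [filterMask_daubechiesCoeff hN,
    norm_sq_eval_daubechiesSymbol hN (norm_exp_neg_two_pi_mul x), hre, mul_pow, Real.sq_sqrt hP,
    ← pow_mul, mul_comm N 2, pow_mul, sq_abs]
  have hc := Real.cos_sq_le_one (Real.pi * x)
  have hc0 := sq_nonneg (Real.cos (Real.pi * x))
  rw [show (1 + (2 * Real.cos (Real.pi * x) ^ 2 - 1)) / 2 = Real.cos (Real.pi * x) ^ 2 by ring]
  gcongr
  exact daubechiesBezoutSum_le_at_one (by linarith) (by linarith)

theorem sqrt_daubechiesBezoutSum_one_lt {N : ℕ} (hN : 2 ≤ N) :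
    √(daubechiesBezoutSum N (1 : ℝ)) < 2 ^ N / 2 := by
  rw [Real.sqrt_lt' (by positivity)]
  refine (daubechiesBezoutSum_one_lt hN).trans_eq ?_
  obtain ⟨n, rfl⟩ : ∃ n, N = n + 1 := ⟨N - 1, by omega⟩
  rw [Nat.add_sub_cancel, pow_succ (2 : ℝ), mul_div_cancel_right₀ _ two_ne_zero, ← pow_mul,
    mul_comm, pow_mul]
  norm_num

theorem integrable_maskProd_daubechies {N : ℕ} (hN : 2 ≤ N) :
    Integrable (maskProd (filterMask (daubechiesCoeff N) (2 * N))) :=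
  (isConjugateMirrorMask_daubechies (by omega)).integrable_maskProd
    (norm_filterMask_daubechies_le (by omega)) (sqrt_daubechiesBezoutSum_one_lt hN)

/-! ### The cascade algorithm and the support of the scaling function -/

/-- The cascade iterates of the indicator function of `(0, 1]`. -/
noncomputable def cascade (c : ℕ → ℝ) (M n : ℕ) : ℝ → ℂ :=
  (subdivision c M)^[n] (Set.indicator (Set.Ioc 0 1) 1)

theorem cascade_succ (c : ℕ → ℝ) (M n : ℕ) :
    cascade c M (n + 1) = subdivision c M (cascade c M n) :=
  Function.iterate_succ_apply' _ _ _

theorem integrable_cascade (c : ℕ → ℝ) (M n : ℕ) : Integrable (cascade c M n) := by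
  induction n with
  | zero =>
    exact (integrable_indicator_iff measurableSet_Ioc).2 (integrableOn_const (by simp))
  | succ n ih =>
    rw [cascade_succ]
    exact integrable_subdivision c M ih

/-- The interval `[0, M - 1]` is stable under subdivision: `2t - l ∈ [0, M - 1]` with `0 ≤ l ≤ M -
1` forces `t ∈ [0, M - 1]`. Since `M ≥ 2`, it contains the initial `(0, 1]`. -/
theorem cascade_eq_zero (c : ℕ → ℝ) {M : ℕ} (hM : 2 ≤ M) (n : ℕ) {t : ℝ}
    (ht : t ∉ Set.Icc (0 : ℝ) (M - 1)) : cascade c M n t = 0 := by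
  have hM' : (2 : ℝ) ≤ M := by exact_mod_cast hM
  induction n generalizing t with
  | zero =>
    refine Set.indicator_of_notMem (fun h => ht ⟨h.1.le, ?_⟩) _
    linarith [h.2]
  | succ n ih =>
    rw [cascade_succ, subdivision, Finset.sum_eq_zero, mul_zero]
    intro l hl
    have hl' : (l : ℝ) + 1 ≤ M := by exact_mod_cast Finset.mem_range.1 hl
    have hl0 : (0 : ℝ) ≤ l := l.cast_nonneg
    rw [ih, mul_zero]
    refine fun h => ht ⟨?_, ?_⟩
    · linarith [h.1]
    · linarith [h.2]

theorem fourier_cascade (c : ℕ → ℝ) (M n : ℕ) (w : ℝ) :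
    𝓕 (cascade c M n) w =
      maskPartialProd (filterMask c M) n w * 𝓕 (cascade c M 0) (w / 2 ^ n) := by
  induction n generalizing w with
  | zero => simp [maskPartialProd]
  | succ n ih =>
    rw [cascade_succ, fourier_subdivision c M (integrable_cascade c M n), ih,
      maskPartialProd_succ', div_div, ← pow_succ', mul_assoc]

/-- The inverse Fourier transform of the infinite product is supported in `[0, M - 1]`. -/
theorem fourierInv_maskProd_eq_zero {c : ℕ → ℝ} {M : ℕ} (hM : 2 ≤ M)
    (hm : IsConjugateMirrorMask (filterMask c M)) (hi : Integrable (maskProd (filterMask c M))) :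
    ∀ᵐ t : ℝ, t ∉ Set.Icc (0 : ℝ) (M - 1) → 𝓕⁻ (maskProd (filterMask c M)) t = 0 := by
  have hf0 : 𝓕 (cascade c M 0) 0 = 1 := by
    rw [Real.fourier_real_eq_integral_exp_smul]
    simp [cascade, integral_indicator, measurableSet_Ioc]
  have hlim : ∀ w, Tendsto (fun n => 𝓕 (cascade c M n) w) atTop
      (𝓝 (maskProd (filterMask c M) w)) := by
    intro w
    have hw : Tendsto (fun n : ℕ => w / 2 ^ n) atTop (𝓝 0) :=
      tendsto_const_nhds.div_atTop (tendsto_pow_atTop_atTop_of_one_lt one_lt_two)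
    have h := (hm.tendsto_maskPartialProd w).mul
      (((continuous_fourier_of_integrable (integrable_cascade c M 0)).tendsto 0).comp hw)
    rw [hf0, mul_one] at h
    exact h.congr fun n => (fourier_cascade c M n w).symm
  set K := ∫ x, ‖cascade c M 0 x‖
  have hbound : ∀ n w, ‖𝓕 (cascade c M n) w‖ ≤ K := by
    intro n w
    rw [fourier_cascade, norm_mul]
    calc _ ≤ 1 * K := mul_le_mul (hm.norm_maskPartialProd_le_one n w)
          (norm_fourier_le_integral_norm _ _) (norm_nonneg _) zero_le_one
      _ = K := one_mul K
  refine (isClosed_Icc.isOpen_compl).ae_eq_zero_of_integral_contDiff_smul_eq_zero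
    ((continuous_fourierInv_of_integrable hi).locallyIntegrable.locallyIntegrableOn _) ?_
  intro g hg hgc hgs
  obtain ⟨G, hG⟩ := exists_schwartzMap_fourier_eq hg hgc
  rw [integral_smul_fourierInv_eq hi hG]
  -- The cascade transforms converge pointwise under a uniform bound, so pairings with a test
  -- function pass to the limit; each vanishes by disjointness of supports.
  have h1 : Tendsto (fun n => ∫ w, G w * 𝓕 (cascade c M n) w) atTop
      (𝓝 (∫ w, G w * maskProd (filterMask c M) w)) := by
    refine tendsto_integral_of_dominated_convergence (fun w => ‖G w‖ * K) (fun n => ?_)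
      (G.integrable.norm.mul_const K) (fun n => Eventually.of_forall fun w => ?_)
      (Eventually.of_forall fun w => (hlim w).const_mul _)
    · exact (G.continuous.mul (continuous_fourier_of_integrable
        (integrable_cascade c M n))).aestronglyMeasurable
    · rw [norm_mul]
      exact mul_le_mul_of_nonneg_left (hbound n w) (norm_nonneg _)
  refine tendsto_nhds_unique h1 ?_
  refine Tendsto.congr (fun n => ?_) tendsto_const_nhds
  rw [← integral_smul_eq_integral_mul_fourier (integrable_cascade c M n) hG]
  symm
  refine integral_eq_zero_of_ae (Eventually.of_forall fun t => ?_)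
  by_cases ht : t ∈ Set.Icc (0 : ℝ) (M - 1)
  · have : g t = 0 := by
      by_contra hne
      exact hgs (subset_tsupport g hne) ht
    simp [this]
  · simp [cascade_eq_zero c hM n ht]

/-! ### The entropy inequality -/

theorem integrable_of_bounded_of_support {u : ℝ → ℝ} {K L : ℝ}
    (hu : AEStronglyMeasurable u volume) (hK : ∀ᵐ t, |u t| ≤ K)
    (hs : ∀ᵐ t, t ∉ Set.Icc 0 L → u t = 0) : Integrable u := by
  have hi : Integrable (Set.indicator (Set.Icc 0 L) fun _ : ℝ => K) volume :=
    (integrable_indicator_iff measurableSet_Icc).2 (integrableOn_const (by simp))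
  refine hi.mono' hu ?_
  filter_upwards [hK, hs] with t h1 h2
  by_cases ht : t ∈ Set.Icc 0 L
  · simpa [ht] using h1
  · simp [ht, h2 ht]

/-- The entropy bound for bounded functions supported in an interval of length `L ≥ e`. -/
theorem integrable_and_timeEntropy_le {ψ : ℝ → ℝ} {K L : ℝ} (hL : Real.exp 1 ≤ L)
    (hψ : AEStronglyMeasurable ψ volume) (hK : ∀ᵐ t, |ψ t| ≤ K)
    (hs : ∀ᵐ t, t ∉ Set.Icc 0 L → ψ t = 0) (h1 : ∫ t, ψ t ^ 2 ≤ 1) :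
    Integrable (fun t : ℝ => ψ t ^ 2 * Real.logb 2 (ψ t ^ 2)) volume ∧
      timeEntropy ψ ≤ Real.logb 2 L := by
  have hL0 : 0 < L := (Real.exp_pos 1).trans_le hL
  have hlogL : 1 ≤ Real.log L := (Real.le_log_iff_exp_le hL0).2 hL
  have hsq : Integrable fun t => ψ t ^ 2 := by
    refine integrable_of_bounded_of_support (K := K ^ 2) (L := L) (hψ.pow 2) ?_ ?_
    · filter_upwards [hK] with t ht
      rw [abs_pow]
      gcongr
    · filter_upwards [hs] with t ht h
      simp [ht h]
  -- `x log x` is continuous up to `x = 0`, hence bounded on the range of `ψ²`.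
  obtain ⟨C, hC⟩ := (isCompact_Icc (a := (0 : ℝ)) (b := K ^ 2)).exists_bound_of_continuousOn
    Real.continuous_mul_log.continuousOn
  have hent : Integrable fun t => ψ t ^ 2 * Real.log (ψ t ^ 2) := by
    refine integrable_of_bounded_of_support (K := C) (L := L)
      (Real.continuous_mul_log.comp_aestronglyMeasurable (hψ.pow 2)) ?_ ?_
    · filter_upwards [hK] with t ht
      refine hC _ ⟨sq_nonneg _, ?_⟩
      rw [← sq_abs]
      gcongr
    · filter_upwards [hs] with t ht h
      simp [ht h]
  have hlog2 : 0 < Real.log 2 := Real.log_pos one_lt_two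
  have heq : ∀ t, ψ t ^ 2 * Real.logb 2 (ψ t ^ 2) =
      ψ t ^ 2 * Real.log (ψ t ^ 2) / Real.log 2 := fun t => by
    rw [← Real.log_div_log, mul_div_assoc]
  simp only [timeEntropy, heq]
  refine ⟨hent.div_const _, ?_⟩
  rw [integral_div, ← neg_div, ← integral_neg, ← Real.log_div_log]
  gcongr
  have hi : Integrable (Set.indicator (Set.Icc 0 L) fun _ : ℝ => 1 / L) volume :=
    (integrable_indicator_iff measurableSet_Icc).2 (integrableOn_const (by simp))
  calc ∫ t, -(ψ t ^ 2 * Real.log (ψ t ^ 2))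
      ≤ ∫ t, (Set.indicator (Set.Icc 0 L) (fun _ : ℝ => 1 / L) t +
          ψ t ^ 2 * (Real.log L - 1)) := by
        refine integral_mono_ae hent.neg (hi.add (hsq.mul_const _)) ?_
        filter_upwards [hs] with t ht
        by_cases hp : ψ t = 0
        · simp only [hp]
          have : 0 ≤ Set.indicator (Set.Icc 0 L) (fun _ : ℝ => 1 / L) t :=
            Set.indicator_nonneg (fun _ _ => by positivity) t
          simpa using this
        · have htm : t ∈ Set.Icc 0 L := by
            by_contra h
            exact hp (ht h)
          rw [Set.indicator_of_mem htm]
          have hp2 : 0 < ψ t ^ 2 := by positivity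
          -- Multiplied by `ψ²`, this reads `-ψ² log ψ² ≤ 1/L + ψ² (log L - 1)`.
          have h := Real.log_le_sub_one_of_pos (x := 1 / (ψ t ^ 2 * L)) (by positivity)
          rw [one_div, Real.log_inv, Real.log_mul hp2.ne' hL0.ne'] at h
          have h' := mul_le_mul_of_nonneg_left h hp2.le
          have h3 : ψ t ^ 2 * ((ψ t ^ 2 * L)⁻¹ - 1) = 1 / L - ψ t ^ 2 := by
            field_simp
          rw [h3] at h'
          linarith
    _ = 1 + (∫ t, ψ t ^ 2) * (Real.log L - 1) := by
        rw [integral_add hi (hsq.mul_const _), integral_mul_const,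
          integral_indicator measurableSet_Icc]
        simp [hL0.le, hL0.ne']
    -- `L ≥ e` enters here: the coefficient `log L - 1` is nonnegative, so `∫ ψ² ≤ 1` suffices.
    _ ≤ Real.log L := by nlinarith

/-! ### Scaling functions and wavelets: transform, existence, norm, support -/

theorem ofReal_filter_sum (a : ℕ → ℝ) (M : ℕ) (φ : ℝ → ℝ) (t : ℝ) :
    ((√2 * ∑ l ∈ Finset.range M, a l * φ (2 * t - (l : ℝ)) : ℝ) : ℂ) =
      subdivision (fun l => a l / √2) M (fun x => (φ x : ℂ)) t := by
  have key : ((√2 : ℝ) : ℂ) = 2 * ((√2 : ℝ) : ℂ)⁻¹ := by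
    rw [eq_mul_inv_iff_mul_eq₀ (by simp), ← Complex.ofReal_mul, Real.mul_self_sqrt zero_le_two]
    simp
  rw [subdivision, Finset.mul_sum, Finset.mul_sum, Complex.ofReal_sum]
  refine Finset.sum_congr rfl fun l _ => ?_
  rw [Complex.ofReal_mul, Complex.ofReal_mul, Complex.ofReal_div]
  linear_combination (a l : ℂ) * φ (2 * t - l) * key

theorem daubechiesHighPass_div (N : ℕ) :
    (fun l => daubechiesHighPass N l / √2) =
      fun l => (-1) ^ l * daubechiesCoeff N (2 * N - 1 - l) := by
  funext l
  rw [daubechiesHighPass, daubechiesCoeff, mul_div_assoc]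

theorem IsDaubechiesScalingFunction.fourier_eq {N : ℕ} (hN : 1 ≤ N) {φ : ℝ → ℝ}
    (h : IsDaubechiesScalingFunction N φ) :
    𝓕 (fun t => (φ t : ℂ)) = maskProd (filterMask (daubechiesCoeff N) (2 * N)) := by
  have hi : Integrable (fun t => (φ t : ℂ)) := h.integrable.ofReal
  refine (isConjugateMirrorMask_daubechies hN).eq_maskProd_of_two_scale
    (continuous_fourier_of_integrable hi).continuousAt ?_ fun w => ?_
  · rw [Real.fourier_real_eq_integral_exp_smul]
    simp only [mul_zero, Complex.ofReal_zero, zero_mul, Complex.exp_zero, one_smul]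
    rw [integral_complex_ofReal, h.integral_eq_one, Complex.ofReal_one]
  · rw [← fourier_subdivision _ _ hi]
    refine Real.fourier_congr_ae ?_ w
    filter_upwards [h.two_scale] with t ht
    rw [ht, ofReal_filter_sum]
    rfl

theorem isDaubechiesScalingFunction_of_fourier_eq {N : ℕ} (hN : 1 ≤ N) {φ : ℝ → ℝ}
    (hi : Integrable φ) (h2 : MemLp φ 2 volume)
    (h : 𝓕 (fun t => (φ t : ℂ)) = maskProd (filterMask (daubechiesCoeff N) (2 * N))) :
    IsDaubechiesScalingFunction N φ := by
  have hm := isConjugateMirrorMask_daubechies hN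
  have hi' : Integrable (fun t => (φ t : ℂ)) := hi.ofReal
  refine ⟨hi, h2, ?_, ?_⟩
  · have h0 := congrFun h 0
    rw [hm.maskProd_zero, Real.fourier_real_eq_integral_exp_smul] at h0
    simp only [mul_zero, Complex.ofReal_zero, zero_mul, Complex.exp_zero, one_smul] at h0
    rw [integral_complex_ofReal] at h0
    exact_mod_cast h0
  · have := ae_eq_of_fourier_eq hi' (integrable_subdivision (daubechiesCoeff N) (2 * N) hi') (by
      funext w
      rw [fourier_subdivision _ _ hi', h, hm.maskProd_two_scale])
    filter_upwards [this] with t ht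
    have hs := ofReal_filter_sum (daubechiesLowPass N) (2 * N) φ t
    exact_mod_cast ht.trans hs.symm

/-- The inverse transform of `Φ` is the candidate: real because `Φ(-w)` is the conjugate of `Φ(w)`,
and in `L¹ ∩ L²` because it is bounded with compact support. Fourier inversion then recovers `Φ`. -/
theorem exists_isDaubechiesScalingFunction_of_two_le {N : ℕ} (hN : 2 ≤ N) :
    ∃ φ, IsDaubechiesScalingFunction N φ := by
  have hN1 : 1 ≤ N := by omega
  have hm := isConjugateMirrorMask_daubechies hN1
  have hi := integrable_maskProd_daubechies hN
  set Φ := maskProd (filterMask (daubechiesCoeff N) (2 * N)) with hΦ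
  have hc := continuous_fourierInv_of_integrable hi
  have hs := fourierInv_maskProd_eq_zero (by omega) hm hi
  have hb := norm_fourierInv_le_integral_norm Φ
  set K := ∫ w, ‖Φ w‖
  have hreal : ∀ t, 𝓕⁻ Φ t = ((𝓕⁻ Φ t).re : ℂ) := by
    intro t
    symm
    rw [← Complex.conj_eq_iff_re, ← fourier_conj_eq, Real.fourierInv_eq_fourier_comp_neg]
    simp only [hΦ, conj_maskProd hm]
  have hb' : ∀ t, |(𝓕⁻ Φ t).re| ≤ K := fun t => (Complex.abs_re_le_norm _).trans (hb t)
  have hmeas : AEStronglyMeasurable (fun t => (𝓕⁻ Φ t).re) volume :=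
    (Complex.continuous_re.comp hc).aestronglyMeasurable
  have hre : Integrable fun t => (𝓕⁻ Φ t).re := by
    refine integrable_of_bounded_of_support (K := K) (L := (2 * N : ℕ) - 1) hmeas
      (Eventually.of_forall hb') ?_
    filter_upwards [hs] with t ht h
    rw [ht h, Complex.zero_re]
  have hint : Integrable (𝓕⁻ Φ) := hre.ofReal.congr (Eventually.of_forall fun t => (hreal t).symm)
  have hF : 𝓕 (𝓕⁻ Φ) = Φ := by
    refine hm.continuous_maskProd.fourier_fourierInv_eq hi (hint.comp_neg.congr ?_)
    refine Eventually.of_forall fun w => ?_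
    simp only [Real.fourierInv_eq_fourier_neg, neg_neg]
    rfl
  refine ⟨fun t => (𝓕⁻ Φ t).re, isDaubechiesScalingFunction_of_fourier_eq hN1 hre ?_ ?_⟩
  · refine (memLp_two_iff_integrable_sq hmeas).2 ?_
    refine integrable_of_bounded_of_support (K := K ^ 2) (L := (2 * N : ℕ) - 1) (hmeas.pow 2)
      (Eventually.of_forall fun t => ?_) ?_
    · rw [abs_pow]
      have := hb' t
      gcongr
    · filter_upwards [hs] with t ht h
      rw [ht h, Complex.zero_re, zero_pow two_ne_zero]
  · rw [← hΦ]
    conv_rhs => rw [← hF]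
    congr 1
    funext t
    exact (hreal t).symm

theorem integral_comp_div_two (u : ℝ → ℝ) : ∫ w, u (w / 2) = 2 * ∫ w, u w := by
  rw [Measure.integral_comp_div]
  simp

/-- The wavelet has the same norm as the scaling function, hence norm at most one. -/
theorem integral_sq_wavelet_le_one {N : ℕ} (hN : 2 ≤ N) {φ ψ : ℝ → ℝ}
    (h : IsDaubechiesScalingFunction N φ)
    (hψ : ∀ᵐ t : ℝ, ψ t =
      √2 * ∑ l ∈ Finset.range (2 * N), daubechiesHighPass N l * φ (2 * t - (l : ℝ))) :
    ∫ t, ψ t ^ 2 ≤ 1 := by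
  have hN1 : 1 ≤ N := by omega
  have hm := isConjugateMirrorMask_daubechies hN1
  have hi := integrable_maskProd_daubechies hN
  have hF := h.fourier_eq hN1
  set m := filterMask (daubechiesCoeff N) (2 * N) with hm_def
  set d : ℕ → ℝ := fun l => (-1) ^ l * daubechiesCoeff N (2 * N - 1 - l) with hd
  have hφi : Integrable (fun t => (φ t : ℂ)) := h.integrable.ofReal
  set Ψ := subdivision d (2 * N) (fun t => (φ t : ℂ))
  have hΨi : Integrable Ψ := integrable_subdivision _ _ hφi
  have hψΨ : ∀ᵐ t, (ψ t : ℂ) = Ψ t := by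
    filter_upwards [hψ] with t ht
    rw [ht, ofReal_filter_sum, daubechiesHighPass_div]
  have hFΨ : 𝓕 Ψ = fun w => filterMask d (2 * N) (w / 2) * maskProd m (w / 2) := by
    funext w
    rw [fourier_subdivision _ _ hφi, hF]
  have hd_norm : ∀ x, ‖filterMask d (2 * N) x‖ ^ 2 = 1 - ‖m x‖ ^ 2 := by
    intro x
    rw [hd, norm_filterMask_alternatingFlip]
    linarith [hm.mirror x]
  have hd_le : ∀ x, ‖filterMask d (2 * N) x‖ ≤ 1 := by
    intro x
    have := hd_norm x
    nlinarith [sq_nonneg ‖m x‖, norm_nonneg (filterMask d (2 * N) x)]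
  have hFΨi : Integrable (𝓕 Ψ) := by
    rw [hFΨ]
    have h1 : Integrable fun w => filterMask d (2 * N) w * maskProd m w :=
      hi.bdd_mul (continuous_filterMask d (2 * N)).aestronglyMeasurable
        (Eventually.of_forall hd_le)
    exact h1.comp_div two_ne_zero
  have hsq := hm.integrable_norm_sq_maskProd hi
  have hmsq : Integrable fun w => ‖m w‖ ^ 2 * ‖maskProd m w‖ ^ 2 := by
    refine hsq.bdd_mul (c := 1) (hm.continuous.norm.pow 2).aestronglyMeasurable
      (Eventually.of_forall fun w => ?_)
    rw [Real.norm_of_nonneg (by positivity)]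
    exact pow_le_one₀ (norm_nonneg _) (hm.norm_le_one w)
  -- By the two-scale relation the low-pass part carries half of `‖Φ‖²`; the high-pass part, with
  -- weight `1 - |m|²`, carries the other half.
  have h2 : ∫ w, ‖maskProd m w‖ ^ 2 = 2 * ∫ w, ‖m w‖ ^ 2 * ‖maskProd m w‖ ^ 2 := by
    rw [← integral_comp_div_two fun w => ‖m w‖ ^ 2 * ‖maskProd m w‖ ^ 2]
    congr 1 with w
    rw [hm.maskProd_two_scale w, norm_mul, mul_pow]
  calc ∫ t, ψ t ^ 2 = ∫ t, ‖Ψ t‖ ^ 2 := by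
        refine integral_congr_ae ?_
        filter_upwards [hψΨ] with t ht
        rw [← ht, Complex.norm_real, Real.norm_eq_abs, sq_abs]
    _ = ∫ w, ‖𝓕 Ψ w‖ ^ 2 := (integral_norm_sq_fourier_eq hΨi hFΨi).symm
    _ = 2 * ∫ w, (‖maskProd m w‖ ^ 2 - ‖m w‖ ^ 2 * ‖maskProd m w‖ ^ 2) := by
        rw [← integral_comp_div_two fun w => ‖maskProd m w‖ ^ 2 - ‖m w‖ ^ 2 * ‖maskProd m w‖ ^ 2]
        congr 1 with w
        rw [hFΨ, norm_mul, mul_pow, hd_norm]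
        ring
    _ = ∫ w, ‖maskProd m w‖ ^ 2 := by
        rw [integral_sub hsq hmsq, mul_sub, ← h2]
        ring
    _ ≤ 1 := hm.integral_norm_sq_maskProd_le_one hsq

theorem IsDaubechiesScalingFunction.bounded_and_support {N : ℕ} (hN : 2 ≤ N) {φ : ℝ → ℝ}
    (h : IsDaubechiesScalingFunction N φ) :
    ∃ K, ∀ᵐ t : ℝ, |φ t| ≤ K ∧ (t ∉ Set.Icc (0 : ℝ) (2 * N - 1) → φ t = 0) := by
  have hN1 : 1 ≤ N := by omega
  have hm := isConjugateMirrorMask_daubechies hN1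
  have hi := integrable_maskProd_daubechies hN
  have hF := h.fourier_eq hN1
  have hφi : Integrable (fun t => (φ t : ℂ)) := h.integrable.ofReal
  have hae := ae_eq_fourierInv_fourier hφi (hF ▸ hi)
  rw [hF] at hae
  refine ⟨∫ w, ‖maskProd (filterMask (daubechiesCoeff N) (2 * N)) w‖, ?_⟩
  filter_upwards [hae, fourierInv_maskProd_eq_zero (by omega) hm hi] with t h1 h2
  refine ⟨?_, fun ht => ?_⟩
  · rw [← Real.norm_eq_abs, ← Complex.norm_real]
    exact h1 ▸ norm_fourierInv_le_integral_norm _ t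
  · have := h2 (by push_cast; exact ht)
    rw [← h1] at this
    exact_mod_cast this

theorem wavelet_bounded_and_support {N : ℕ} {φ ψ : ℝ → ℝ} {K : ℝ}
    (h : ∀ᵐ t : ℝ, |φ t| ≤ K ∧ (t ∉ Set.Icc (0 : ℝ) (2 * N - 1) → φ t = 0))
    (hψ : ∀ᵐ t : ℝ, ψ t =
      √2 * ∑ l ∈ Finset.range (2 * N), daubechiesHighPass N l * φ (2 * t - (l : ℝ))) :
    ∀ᵐ t : ℝ, |ψ t| ≤ √2 * ∑ l ∈ Finset.range (2 * N), |daubechiesHighPass N l| * K ∧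
      (t ∉ Set.Icc (0 : ℝ) (2 * N - 1) → ψ t = 0) := by
  filter_upwards [hψ, ae_all_iff.2 fun l : ℕ => ae_comp_two_mul_sub h l] with t h1 h2
  refine ⟨?_, fun ht => ?_⟩
  · rw [h1, abs_mul, abs_of_nonneg (Real.sqrt_nonneg 2)]
    gcongr
    refine (Finset.abs_sum_le_sum_abs _ _).trans (Finset.sum_le_sum fun l _ => ?_)
    rw [abs_mul]
    gcongr
    exact (h2 l).1
  · rw [h1, Finset.sum_eq_zero, mul_zero]
    intro l hl
    have hl' : (l : ℝ) + 1 ≤ 2 * N := by exact_mod_cast Finset.mem_range.1 hl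
    have hl0 : (0 : ℝ) ≤ l := l.cast_nonneg
    rw [(h2 l).2, mul_zero]
    refine fun h => ht ⟨?_, ?_⟩
    · linarith [h.1]
    · linarith [h.2]

theorem integrable_and_timeEntropy_wavelet_le {N : ℕ} (hN : 2 ≤ N) {ψ : ℝ → ℝ}
    (h : IsDaubechiesWavelet N ψ) :
    Integrable (fun t : ℝ => ψ t ^ 2 * Real.logb 2 (ψ t ^ 2)) volume ∧
      timeEntropy ψ ≤ Real.logb 2 (2 * (N : ℝ) - 1) := by
  obtain ⟨φ, hφ, hψ⟩ := h
  obtain ⟨K, hK⟩ := hφ.bounded_and_support hN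
  have hb := wavelet_bounded_and_support hK hψ
  -- `N ≥ 2` gives `2N - 1 ≥ 3 > e`.
  have hL : Real.exp 1 ≤ 2 * (N : ℝ) - 1 := by
    have : (2 : ℝ) ≤ N := by exact_mod_cast hN
    linarith [Real.exp_one_lt_d9]
  refine integrable_and_timeEntropy_le hL ?_ (hb.mono fun _ h => h.1) (hb.mono fun _ h => h.2)
    (integral_sq_wavelet_le_one hN hφ hψ)
  have hmeas : Integrable fun t : ℝ =>
      √2 * ∑ l ∈ Finset.range (2 * N), daubechiesHighPass N l * φ (2 * t - (l : ℝ)) := by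
    refine (integrable_finsetSum _ fun l _ => ?_).const_mul _
    exact ((hφ.integrable.comp_sub_right _).comp_mul_left' two_ne_zero).const_mul _
  exact hmeas.aestronglyMeasurable.congr (hψ.mono fun _ h => h.symm)

/-! ### The Haar case and the conclusion -/

open Polynomial in
theorem daubechiesSymbol_one : daubechiesSymbol 1 = C (1 / 2) * (1 + X) := by
  have hQ : daubechiesProductPoly 1 = 1 := by simp [daubechiesProductPoly]
  have hL : daubechiesSpectralFactor 1 = 1 := by simp [daubechiesSpectralFactor, hQ]
  simp [daubechiesSymbol, hL]

theorem daubechiesLowPass_one_zero : daubechiesLowPass 1 0 = √2 * (1 / 2) := by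
  simp [daubechiesLowPass, daubechiesSymbol_one]

theorem daubechiesLowPass_one_one : daubechiesLowPass 1 1 = √2 * (1 / 2) := by
  simp [daubechiesLowPass, daubechiesSymbol_one, Polynomial.coeff_one]

theorem sqrt_two_mul_sqrt_two_mul_half (x : ℝ) : √2 * (√2 * (1 / 2) * x) = x := by
  have h : √2 * √2 = (2 : ℝ) := Real.mul_self_sqrt zero_le_two
  linear_combination (x / 2) * h

/-- The Haar scaling function. -/
theorem isDaubechiesScalingFunction_indicator :
    IsDaubechiesScalingFunction 1 (Set.indicator (Set.Ico 0 1) 1) := by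
  have hi : Integrable (Set.indicator (Set.Ico (0 : ℝ) 1) (1 : ℝ → ℝ)) :=
    (integrable_indicator_iff measurableSet_Ico).2 (integrableOn_const (by simp))
  refine ⟨hi, ?_, by simp [integral_indicator, measurableSet_Ico], ?_⟩
  · exact (memLp_indicator_const 2 measurableSet_Ico (1 : ℝ) (Or.inr (by simp)))
  · refine Eventually.of_forall fun t => ?_
    rw [mul_one, Finset.sum_range_succ, Finset.sum_range_one, daubechiesLowPass_one_zero,
      daubechiesLowPass_one_one, ← mul_add, sqrt_two_mul_sqrt_two_mul_half]
    simp only [Set.indicator_apply, Set.mem_Ico, Pi.one_apply, Nat.cast_zero, Nat.cast_one]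
    split_ifs <;> grind

theorem IsDaubechiesScalingFunction.ae_eq {N : ℕ} (hN : 1 ≤ N) {φ φ' : ℝ → ℝ}
    (h : IsDaubechiesScalingFunction N φ) (h' : IsDaubechiesScalingFunction N φ') :
    ∀ᵐ t, φ t = φ' t := by
  have hi : Integrable (fun t => (φ t : ℂ)) := h.integrable.ofReal
  have hi' : Integrable (fun t => (φ' t : ℂ)) := h'.integrable.ofReal
  filter_upwards [ae_eq_of_fourier_eq hi hi' ((h.fourier_eq hN).trans (h'.fourier_eq hN).symm)]
    with t ht
  exact_mod_cast ht

/-- By uniqueness `φ` is a.e. the indicator of `[0, 1)`, so `ψ` takes only the values `0, 1, -1`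
a.e. -/
theorem sq_mul_logb_haar_wavelet {ψ : ℝ → ℝ} (h : IsDaubechiesWavelet 1 ψ) :
    ∀ᵐ t, ψ t ^ 2 * Real.logb 2 (ψ t ^ 2) = 0 := by
  obtain ⟨φ, hφ, hψ⟩ := h
  have hae := hφ.ae_eq le_rfl isDaubechiesScalingFunction_indicator
  filter_upwards [hψ, ae_all_iff.2 fun l : ℕ => ae_comp_two_mul_sub hae l] with t h1 h2
  have h3 : ψ t = Set.indicator (Set.Ico 0 1) 1 (2 * t) -
      Set.indicator (Set.Ico 0 1) 1 (2 * t - 1) := by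
    rw [h1, mul_one, Finset.sum_range_succ, Finset.sum_range_one, h2 0, h2 1]
    simp only [daubechiesHighPass, mul_one, pow_zero, pow_one, one_mul, Nat.reduceSub,
      daubechiesLowPass_one_zero, daubechiesLowPass_one_one, Nat.cast_zero, Nat.cast_one, sub_zero]
    linear_combination sqrt_two_mul_sqrt_two_mul_half (Set.indicator (Set.Ico (0 : ℝ) 1)
      (1 : ℝ → ℝ) (2 * t) - Set.indicator (Set.Ico 0 1) 1 (2 * t - 1))
  rw [h3]
  simp only [Set.indicator_apply, Set.mem_Ico, Pi.one_apply]
  split_ifs <;> simp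

theorem exists_isDaubechiesScalingFunction {N : ℕ} (hN : 1 ≤ N) :
    ∃ φ, IsDaubechiesScalingFunction N φ := by
  rcases hN.eq_or_lt with rfl | hN
  · exact ⟨_, isDaubechiesScalingFunction_indicator⟩
  · exact exists_isDaubechiesScalingFunction_of_two_le hN

theorem mainTheorem6 (N : ℕ) (hN : 1 ≤ N) :
    (∃ ψ : ℝ → ℝ, IsDaubechiesWavelet N ψ) ∧
    ∀ ψ : ℝ → ℝ, IsDaubechiesWavelet N ψ →
      Integrable (fun t : ℝ => ψ t ^ 2 * Real.logb 2 (ψ t ^ 2)) volume ∧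
      timeEntropy ψ ≤ Real.logb 2 (2 * (N : ℝ) - 1) := by
  refine ⟨?_, fun ψ hψ => ?_⟩
  · obtain ⟨φ, hφ⟩ := exists_isDaubechiesScalingFunction hN
    exact ⟨_, φ, hφ, Eventually.of_forall fun _ => rfl⟩
  · rcases hN.eq_or_lt with rfl | hN
    · have h := sq_mul_logb_haar_wavelet hψ
      refine ⟨(integrable_zero ℝ ℝ volume).congr (h.mono fun t ht => ht.symm), ?_⟩
      rw [timeEntropy, integral_eq_zero_of_ae h]
      norm_num
    · exact integrable_and_timeEntropy_wavelet_le hN hψ
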